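/- Let $\Sigma$ be a compact (Hausdorff) smooth manifold of dimension $k$, possibly with boundary, let $m\ge 0$ be an integer, and let $g_0$ be the Euclidean metric on $\mathbb{R}^m$. Fix a smooth Riemannian metric $g$ on $\Sigma$; "almost everywhere", "measurable" and "ess sup" refer to the Riemannian volume measure $\mathrm{vol}_g$. For two inner products $b,c$ on a $k$-dimensional real vector space $V$ put $$d_P(b,c)=\Big(\sum_{i=1}^k \log(\lambda_i)^2\Big)^{1/2},$$ where $\lambda_1,\dots,\lambda_k$ are the eigenvalues (with multiplicity) of the Gram matrix of $c$ with respect to the Gram matrix of $b$ (in any basis of $V$). Let $\mathcal{P}(\Sigma)$ be the set of measurable, almost everywhere defined sections $b$, $x\mapsto b|_x$, with $b|_x$ an inner product on $T_x\Sigma$, such that $\operatorname{ess\,sup}_{x} d_P(b|_x,g|_x)<\infty$, where sections that agree almost everywhere are identified; for $b_1,b_2\in\mathcal{P}(\Sigma)$ put $d_{\mathcal{P}}(b_1,b_2)=\operatorname{ess\,sup}_{x} d_P(b_1|_x,b_2|_x)$. Every $f\in W^{1,\infty}(\Sigma;\mathbb{R}^m)$ has an almost everywhere defined differential $\mathrm{d}f$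 and an almost everywhere defined pullback $f^\# g_0=g_0(\mathrm{d}f\,\cdot,\mathrm{d}f\,\cdot)$. The space of Lipschitz immersions is $$\mathrm{Imm}(\Sigma;\mathbb{R}^m)=\{f\in W^{1,\infty}(\Sigma;\mathbb{R}^m) : f^\# g_0\in\mathcal{P}(\Sigma)\},$$ and for $f_1,f_2\in \mathrm{Imm}(\Sigma;\mathbb{R}^m)$ put $$d_{\mathrm{Imm}}(f_1,f_2)=\|f_1-f_2\|_{L^\infty}+d_{\mathcal{P}}(f_1^\# g_0,f_2^\# g_0)+\operatorname*{ess\,sup}_{x\in\Sigma}\ \sup_{u\in T_x\Sigma\setminus\{0\}}\measuredangle\big(\mathrm{d}f_1|_x u,\ \mathrm{d}f_2|_x u\big),$$ where $\measuredangle$ is the unoriented Euclidean angle, with values in $[0,\pi]$. **Theorem.** $d_{\mathrm{Imm}}$ is a metric on $\mathrm{Imm}(\Sigma;\mathbb{R}^m)$, and the metric space $(\mathrm{Imm}(\Sigma;\mathbb{R}^m),d_{\mathrm{Imm}})$ is complete. -/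

import Mathlib

open MeasureTheory Set
open scoped Manifold ContDiff ENNReal

namespace LipschitzImmersion

noncomputable section

/-! ### The space of inner products on a finite-dimensional vector space -/

section InnerProducts

variable {k : ℕ} {V : Type*} [AddCommGroup V] [Module ℝ V]

/-- `b` is a (positive definite, symmetric) inner product on `V`, i.e. `b ∈ P(V)`. -/
def IsInnerProduct (b : LinearMap.BilinForm ℝ V) : Prop :=
  (∀ u v, b u v = b v u) ∧ ∀ v, v ≠ 0 → 0 < b v v

/-- The eigenvalues (with multiplicity) of the Gram matrix of `c` with respect to the Gram matrix
of `b`, i.e. the solutions `t` of `det (G_e(c) - t G_e(b)) = 0`. -/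
def relEigenvalues (e : Module.Basis (Fin k) ℝ V) (b c : LinearMap.BilinForm ℝ V) : Multiset ℝ :=
  ((LinearMap.BilinForm.toMatrix e b)⁻¹ * LinearMap.BilinForm.toMatrix e c).charpoly.roots

/-- The distance `d_P(b, c) = (∑ i, (log λ_i)²)^(1/2)` on `P(V)`. -/
def dP (e : Module.Basis (Fin k) ℝ V) (b c : LinearMap.BilinForm ℝ V) : ℝ :=
  √((relEigenvalues e b c).map fun t => (Real.log t) ^ 2).sum

/-- The pullback `A^# g₀` of the Euclidean inner product of `ℝ^m`. -/
def pullback {m : ℕ} (A : V →ₗ[ℝ] EuclideanSpace ℝ (Fin m)) : LinearMap.BilinForm ℝ V :=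
  (innerₗ (EuclideanSpace ℝ (Fin m))).compl₁₂ A A

/-- The distance `d_∞` between the maps induced by `A` and `B` on the spaces of rays: the supremum
over all `u ≠ 0` of the angle between `A u` and `B u`. -/
def rayDist {m : ℕ} (A B : V →ₗ[ℝ] EuclideanSpace ℝ (Fin m)) : ℝ≥0∞ :=
  ⨆ (u : V) (_ : u ≠ 0), ENNReal.ofReal (InnerProductGeometry.angle (A u) (B u))

end InnerProducts

section Manifold

variable {k : ℕ} {H : Type*} [TopologicalSpace H]
  (I : ModelWithCorners ℝ (EuclideanSpace ℝ (Fin k)) H)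
  {M : Type*} [TopologicalSpace M] [ChartedSpace H M]

/-- A basis of the tangent space. The distance `dP` does not depend on the basis. -/
def tangentBasis (x : M) : Module.Basis (Fin k) ℝ (TangentSpace I x) :=
  (EuclideanSpace.basisFun (Fin k) ℝ).toBasis

/-- The inverse of the chart around `x₀`. -/
def chartInv (x₀ : M) : EuclideanSpace ℝ (Fin k) → M :=
  (extChartAt I x₀).symm

/-- The `i`-th coordinate vector field of the chart around `x₀`, at the point of `M` that has the
coordinates `y`. -/
def coordVector (x₀ : M) (y : EuclideanSpace ℝ (Fin k)) (i : Fin k) :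
    TangentSpace I (chartInv I x₀ y) :=
  mfderivWithin 𝓘(ℝ, EuclideanSpace ℝ (Fin k)) I (chartInv I x₀) (range I) y
    (EuclideanSpace.single i (1 : ℝ) : EuclideanSpace ℝ (Fin k))

/-- Test-function formulation of: the section `F` of `Hom(TM, ℝ^m)` is the weak differential
of `f : M → ℝ^m`. -/
def IsWeakDifferential {m : ℕ} (f : M → EuclideanSpace ℝ (Fin m))
    (F : ∀ x : M, TangentSpace I x →ₗ[ℝ] EuclideanSpace ℝ (Fin m)) : Prop :=
  ∀ x₀ : M,
    LocallyIntegrableOn (fun y => f (chartInv I x₀ y))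
      (interior (extChartAt I x₀).target) volume ∧
    ∀ i : Fin k,
      LocallyIntegrableOn (fun y => F (chartInv I x₀ y) (coordVector I x₀ y i))
        (interior (extChartAt I x₀).target) volume ∧
      ∀ ψ : EuclideanSpace ℝ (Fin k) → ℝ, ContDiff ℝ ∞ ψ → HasCompactSupport ψ →
        tsupport ψ ⊆ interior (extChartAt I x₀).target →
        ∫ y, (fderiv ℝ ψ y (EuclideanSpace.single i (1 : ℝ))) • f (chartInv I x₀ y) =
          - ∫ y, ψ y • F (chartInv I x₀ y) (coordVector I x₀ y i)

variable {I} [IsManifold I ∞ M]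
  (g : Bundle.ContMDiffRiemannianMetric I ∞ (EuclideanSpace ℝ (Fin k))
    (fun x : M => TangentSpace I x))

/-- The Riemannian metric at `x`, as a bilinear form. -/
def metricForm (x : M) : LinearMap.BilinForm ℝ (TangentSpace I x) :=
  LinearMap.mk₂ ℝ (fun u v => g.inner x u v) (by simp) (by simp) (by simp) (by simp)

section Volume

variable [MeasurableSpace M]

/-- The restriction of the Riemannian volume measure to the domain of the chart around `x₀`: the
measure with density `√(det g_ij)` in the coordinates of the chart. -/
def chartVol (x₀ : M) : Measure M :=
  Measure.map (chartInv I x₀)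
    ((volume.restrict (extChartAt I x₀).target).withDensity fun y =>
      ENNReal.ofReal √(Matrix.det (Matrix.of fun i j : Fin k =>
        metricForm g (chartInv I x₀ y) (coordVector I x₀ y i) (coordVector I x₀ y j))))

/-- The Riemannian volume measure `vol_g`: as its restrictions to the chart domains are the
measures `chartVol g x₀`, it is the supremum of these in the lattice of measures. -/
def vol : Measure M := ⨆ x₀ : M, chartVol g x₀

/-- The distance `d_𝓟(b₁, b₂) = ess sup_x d_P(b₁|_x, b₂|_x)`. -/
def dPSup (b₁ b₂ : ∀ x : M, LinearMap.BilinForm ℝ (TangentSpace I x)) : ℝ≥0∞ :=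
  essSup (fun x => ENNReal.ofReal (dP (tangentBasis I x) (b₁ x) (b₂ x))) (vol g)

/-- `b` represents an element of `𝓟(M)`: it is a measurable section of the bundle of inner products
on the tangent spaces with `ess sup_x d_P(b|_x, g|_x) < ∞`. -/
structure MemP (b : ∀ x : M, LinearMap.BilinForm ℝ (TangentSpace I x)) : Prop where
  measurable : ∀ (x₀ : M) (i j : Fin k),
    AEMeasurable (fun y => b (chartInv I x₀ y) (coordVector I x₀ y i) (coordVector I x₀ y j))
      (volume.restrict (extChartAt I x₀).target)
  isInnerProduct : ∀ᵐ x ∂vol g, IsInnerProduct (b x)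
  bounded : dPSup g b (metricForm g) < ⊤

/-- `F` is the weak differential of `f`, and it is essentially bounded with respect to `g`. -/
def IsLInftyDifferential {m : ℕ} (f : M → EuclideanSpace ℝ (Fin m))
    (F : ∀ x : M, TangentSpace I x →ₗ[ℝ] EuclideanSpace ℝ (Fin m)) : Prop :=
  IsWeakDifferential I f F ∧
    ∃ C : ℝ, ∀ᵐ x ∂vol g, ∀ u : TangentSpace I x, ‖F x u‖ ≤ C * √(metricForm g x u u)

/-- The Sobolev space `W^{1,∞}(M; ℝ^m)`, as a set of (classes of) functions in `L^∞`. -/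
def sobolevOneInfty (m : ℕ) : Set (Lp (EuclideanSpace ℝ (Fin m)) ⊤ (vol g)) :=
  {f | ∃ F : ∀ x : M, TangentSpace I x →ₗ[ℝ] EuclideanSpace ℝ (Fin m),
    IsLInftyDifferential g f F}

open Classical in
/-- The differential `df` of `f ∈ W^{1,∞}(M; ℝ^m)`. It is unique almost everywhere. -/
def differential {m : ℕ} (f : Lp (EuclideanSpace ℝ (Fin m)) ⊤ (vol g)) :
    ∀ x : M, TangentSpace I x →ₗ[ℝ] EuclideanSpace ℝ (Fin m) :=
  if hf : f ∈ sobolevOneInfty g m then hf.choose else fun _ => 0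

/-- The space `Imm(M; ℝ^m)` of Lipschitz immersions. -/
def Imm (m : ℕ) : Type _ :=
  {f : Lp (EuclideanSpace ℝ (Fin m)) ⊤ (vol g) //
    f ∈ sobolevOneInfty g m ∧ MemP g fun x => pullback (differential g f x)}

/-- The distance `d_Imm`. -/
def dImm {m : ℕ} (f₁ f₂ : Imm g m) : ℝ≥0∞ :=
  eLpNorm (f₁.1 - f₂.1 : M → EuclideanSpace ℝ (Fin m)) ⊤ (vol g) +
    dPSup g (fun x => pullback (differential g f₁.1 x))
      (fun x => pullback (differential g f₂.1 x)) +
    essSup (fun x => rayDist (differential g f₁.1 x) (differential g f₂.1 x)) (vol g)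

end Volume

end Manifold

end

end LipschitzImmersion

/-!
The distance `d_Imm` is a sum of three essential suprema, and `differential` is an arbitrary
choice of weak differential; the choice does not matter, as weak differentials are unique almost
everywhere (`IsWeakDifferential.ae_eq`). All almost everywhere statements are moved between the
Riemannian volume and Lebesgue measure in the charts by `ae_chartInv_of_ae_vol` and
`ae_vol_of_ae_chartInv`. The latter uses that the transition maps are differentiable, hence preserve
null sets, and that finitely many charts cover the compact manifold.

That `d_Imm` is a metric rests on the triangle inequality for `d_P` (`dP_triangle`), that is, on the
fact that the affine invariant distance of positive definite matrices is a distance. Let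
`M t` be the geodesic from `b` to `c`, with eigenvalues `exp (t * l i)` with respect to `b`, and let
`p i` be the eigenvalues of `M t` with respect to `a`. The derivative of
`d_P(a, M t)² = ∑ i, log (p i) ^ 2` is `2 ∑ i j, W i j * log (p i) * l j` with a doubly stochastic
matrix `W`, so by the Cauchy–Schwarz inequality it is at most `2 d_P(a, M t) d_P(b, c)`
(`first_order_term_le`). Hence `d_P(a, M t)` grows at most with speed `d_P(b, c)`. The proof works
with a finite step version of this: the first order expansion of a trace function
(`Diagonalizes.sum_log_sq_le`) has a quadratic error that is uniform along the geodesic, so the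
differentiability of the eigenvalues is not needed (`sqrt_le_sqrt_add_of_step`).

For completeness, consider a Cauchy sequence of immersions. The maps converge uniformly. At almost
every point, `d_P` controls the ratios of the lengths of the vectors `df_n u`, and the last term of
`d_Imm` controls the angles between them, so the differentials converge pointwise
(`exists_tendsto_of_cauchy`), and they are all bounded by a multiple of the first one. By dominated
convergence against test functions the limit is the weak differential of the limit map
(`isWeakDifferential_of_tendsto`). The Cauchy bounds on lengths and angles pass to the limit
(`isInnerProduct_and_dist_le_of_tendsto`); since bounds on lengths give back bounds for `d_P`
(`dP_le_of_le_exp_mul`), the limit is an immersion and the convergence is in `d_Imm`.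
-/

namespace LipschitzImmersion

/-! ### Simultaneous diagonalization of inner products -/

section Diagonalization

variable {k : ℕ} {V : Type*} [AddCommGroup V] [Module ℝ V]

/-- The basis `w` is orthonormal for `a`, and orthogonal for `b` with `b (w i) (w i) = q i`. -/
structure Diagonalizes (a b : LinearMap.BilinForm ℝ V) (w : Module.Basis (Fin k) ℝ V)
    (q : Fin k → ℝ) : Prop where
  left : ∀ i j, a (w i) (w j) = if i = j then 1 else 0
  right : ∀ i j, b (w i) (w j) = if i = j then q i else 0

theorem IsInnerProduct.nonneg {b : LinearMap.BilinForm ℝ V} (hb : IsInnerProduct b) (u : V) :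
    0 ≤ b u u := by
  by_cases hu : u = 0
  · simp [hu]
  · exact (hb.2 u hu).le

theorem IsInnerProduct.exists_orthonormal (e : Module.Basis (Fin k) ℝ V)
    {a : LinearMap.BilinForm ℝ V} (ha : IsInnerProduct a) :
    ∃ v : Module.Basis (Fin k) ℝ V, ∀ i j, a (v i) (v j) = if i = j then 1 else 0 := by
  have : Module.Finite ℝ V := Module.Finite.of_basis e
  have hs : LinearMap.IsSymm a := ⟨fun u v => by simpa using ha.1 u v⟩
  have hk : Module.finrank ℝ V = k := by simp [Module.finrank_eq_card_basis e]
  have hex := LinearMap.BilinForm.exists_orthogonal_basis hs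
  rw [hk] at hex
  obtain ⟨v, hv⟩ := hex
  have hpos : ∀ i, 0 < a (v i) (v i) := fun i => ha.2 _ (v.ne_zero i)
  have hne : ∀ i, √(a (v i) (v i)) ≠ 0 := fun i => (Real.sqrt_pos.2 (hpos i)).ne'
  refine ⟨v.unitsSMul fun i => Units.mk0 (√(a (v i) (v i)))⁻¹ (inv_ne_zero (hne i)), ?_⟩
  intro i j
  simp only [Module.Basis.unitsSMul_apply, Units.smul_mk0, map_smul, LinearMap.smul_apply,
    smul_eq_mul]
  split_ifs with h
  · subst h
    rw [← mul_assoc, ← mul_inv, Real.mul_self_sqrt (hpos i).le, inv_mul_cancel₀ (hpos i).ne']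
  · have : a (v i) (v j) = 0 := hv h
    simp [this]

/-- Two inner products have a common orthogonal basis, by the spectral theorem for the Gram matrix
of `b` in an orthonormal basis of `a`. -/
theorem IsInnerProduct.exists_diagonalizes (e : Module.Basis (Fin k) ℝ V)
    {a b : LinearMap.BilinForm ℝ V} (ha : IsInnerProduct a) (hb : IsInnerProduct b) :
    ∃ (w : Module.Basis (Fin k) ℝ V) (q : Fin k → ℝ), Diagonalizes a b w q ∧ ∀ i, 0 < q i := by
  obtain ⟨v, hv⟩ := ha.exists_orthonormal e
  set C : Matrix (Fin k) (Fin k) ℝ := Matrix.of fun i j => b (v i) (v j) with hC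
  have hherm : C.IsHermitian := by
    ext i j
    simp [hC, hb.1 (v j) (v i)]
  set o := hherm.eigenvectorBasis with ho
  let L : EuclideanSpace ℝ (Fin k) ≃ₗ[ℝ] V :=
    (WithLp.linearEquiv 2 ℝ (Fin k → ℝ)).trans v.equivFun.symm
  have hL : ∀ x, L x = ∑ i, x i • v i := fun x => by
    simp [L, Module.Basis.equivFun_symm_apply]
  let w := o.toBasis.map L
  have hw : ∀ j, w j = ∑ i, o j i • v i := fun j => by
    simp [w, hL]
  have hexp : ∀ (c : LinearMap.BilinForm ℝ V) (i j : Fin k),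
      c (w i) (w j) = ∑ p, ∑ r, o i p * (o j r * c (v p) (v r)) := by
    intro c i j
    rw [hw, hw]
    rw [Finset.sum_comm]
    simp [map_sum, LinearMap.sum_apply, Finset.mul_sum, mul_left_comm]
  have horth : ∀ i j, ∑ p, o i p * o j p = if i = j then 1 else 0 := by
    intro i j
    rw [← o.inner_eq_ite i j]
    simp [PiLp.inner_apply, mul_comm]
  have hd : Diagonalizes a b w hherm.eigenvalues := by
    constructor
    · intro i j
      rw [hexp, ← horth i j]
      simp [hv]
    · intro i j
      have h2 : ∀ p, ∑ r, o j r * b (v p) (v r) = hherm.eigenvalues j * o j p := by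
        intro p
        have := congrFun (hherm.mulVec_eigenvectorBasis j) p
        simp only [Matrix.mulVec, dotProduct, Pi.smul_apply, smul_eq_mul] at this
        rw [← this]
        exact Finset.sum_congr rfl fun r _ => by simp [hC, ho, mul_comm]
      rw [hexp]
      simp_rw [← Finset.mul_sum, h2]
      calc ∑ p, o i p * (hherm.eigenvalues j * o j p)
          = hherm.eigenvalues j * ∑ p, o i p * o j p := by
            rw [Finset.mul_sum]
            exact Finset.sum_congr rfl fun _ _ => by ring
        _ = _ := by
            rw [horth]
            split_ifs with h <;> simp [h]
  refine ⟨w, _, hd, fun i => ?_⟩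
  have := hb.2 (w i) (w.ne_zero i)
  rwa [hd.right, if_pos rfl] at this

namespace Diagonalizes

variable {a b : LinearMap.BilinForm ℝ V} {w : Module.Basis (Fin k) ℝ V} {q : Fin k → ℝ}

theorem repr_eq (h : Diagonalizes a b w q) (u : V) (j : Fin k) : w.repr u j = a u (w j) := by
  have := congrArg (fun u => a u (w j)) (w.sum_repr u)
  simpa [-Module.Basis.sum_repr, h.left] using this

theorem right_eq_sum (h : Diagonalizes a b w q) (u u' : V) :
    b u u' = ∑ j, q j * a u (w j) * a u' (w j) := by
  conv_lhs => rw [← w.sum_repr u, ← w.sum_repr u']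
  simp only [map_sum, LinearMap.sum_apply, map_smul, LinearMap.smul_apply, smul_eq_mul, h.right,
    h.repr_eq]
  simp [mul_comm, mul_left_comm]

theorem left_eq_sum (h : Diagonalizes a b w q) (u u' : V) :
    a u u' = ∑ j, a u (w j) * a u' (w j) := by
  have h' : Diagonalizes a a w 1 := ⟨h.left, h.left⟩
  simpa using h'.right_eq_sum u u'

theorem right_apply (h : Diagonalizes a b w q) (u : V) (j : Fin k) :
    b u (w j) = q j * a u (w j) := by
  rw [h.right_eq_sum]
  simp [h.left]

/-- In a diagonalizing basis with transition matrix `P`, the matrix that defines the relative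
eigenvalues is the conjugate `P⁻¹ * diagonal q * P`. -/
theorem relEigenvalues_eq (h : Diagonalizes a b w q) (e : Module.Basis (Fin k) ℝ V) :
    relEigenvalues e a b = Finset.univ.val.map q := by
  classical
  set P := w.toMatrix e
  have hP : IsUnit P := by
    have := w.invertibleToMatrix e
    exact isUnit_of_invertible P
  have ha : LinearMap.BilinForm.toMatrix w a = 1 := by
    ext i j
    simp [LinearMap.BilinForm.toMatrix_apply, h.left, Matrix.one_apply]
  have hb : LinearMap.BilinForm.toMatrix w b = Matrix.diagonal q := by
    ext i j
    simp [LinearMap.BilinForm.toMatrix_apply, h.right, Matrix.diagonal_apply]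
  obtain ⟨U, hU⟩ := hP
  have hdet : IsUnit P.det := (Matrix.isUnit_iff_isUnit_det P).1 ⟨U, hU⟩
  have hdet' : IsUnit (P.transpose).det := by rwa [Matrix.det_transpose]
  have key : (LinearMap.BilinForm.toMatrix e a)⁻¹ * LinearMap.BilinForm.toMatrix e b
      = P⁻¹ * Matrix.diagonal q * P := by
    rw [← LinearMap.BilinForm.toMatrix_mul_basis_toMatrix w e a,
      ← LinearMap.BilinForm.toMatrix_mul_basis_toMatrix w e b, ha, hb, mul_one,
      Matrix.mul_inv_rev]
    rw [Matrix.mul_assoc, ← Matrix.mul_assoc (P.transpose)⁻¹, ← Matrix.mul_assoc (P.transpose)⁻¹,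
      Matrix.nonsing_inv_mul _ hdet', Matrix.one_mul, Matrix.mul_assoc]
  rw [relEigenvalues, key, ← hU, Matrix.charpoly_units_conj', Matrix.charpoly_diagonal]
  have := Polynomial.roots_multiset_prod_X_sub_C (Finset.univ.val.map q)
  rw [Multiset.map_map] at this
  exact this

/-- The formula for `d_P` in a diagonalizing basis; in particular `d_P` does not depend on the
basis `e`. -/
theorem dP_eq (h : Diagonalizes a b w q) (e : Module.Basis (Fin k) ℝ V) :
    dP e a b = √(∑ i, Real.log (q i) ^ 2) := by
  rw [dP, h.relEigenvalues_eq e, Multiset.map_map]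
  rfl

theorem symm (h : Diagonalizes a b w q) (hq : ∀ i, 0 < q i) :
    ∃ w' : Module.Basis (Fin k) ℝ V, Diagonalizes b a w' q⁻¹ := by
  have hne : ∀ i, √(q i) ≠ 0 := fun i => (Real.sqrt_pos.2 (hq i)).ne'
  refine ⟨w.unitsSMul fun i => Units.mk0 (√(q i))⁻¹ (inv_ne_zero (hne i)), ?_, ?_⟩
  all_goals
    intro i j
    simp only [Module.Basis.unitsSMul_apply, Units.smul_mk0, map_smul, LinearMap.smul_apply,
      smul_eq_mul, h.left, h.right]
    split_ifs with h
    · subst h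
      rw [← mul_assoc, ← mul_inv, Real.mul_self_sqrt (hq i).le]
      simp [(hq i).ne']
    · simp

end Diagonalizes

theorem dP_comm (e : Module.Basis (Fin k) ℝ V) {a b : LinearMap.BilinForm ℝ V}
    (ha : IsInnerProduct a) (hb : IsInnerProduct b) : dP e a b = dP e b a := by
  obtain ⟨w, q, h, hq⟩ := ha.exists_diagonalizes e hb
  obtain ⟨w', h'⟩ := h.symm hq
  rw [h.dP_eq e, h'.dP_eq e]
  simp

theorem dP_self (e : Module.Basis (Fin k) ℝ V) {a : LinearMap.BilinForm ℝ V}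
    (ha : IsInnerProduct a) : dP e a a = 0 := by
  obtain ⟨v, hv⟩ := ha.exists_orthonormal e
  have h' : Diagonalizes a a v 1 := ⟨hv, hv⟩
  simp [h'.dP_eq e]

theorem dP_nonneg (e : Module.Basis (Fin k) ℝ V) (a b : LinearMap.BilinForm ℝ V) :
    0 ≤ dP e a b := Real.sqrt_nonneg _

/-- Forms at distance `s` for `d_P` differ at most by the factor `exp s`. -/
theorem le_exp_dP_mul (e : Module.Basis (Fin k) ℝ V) {a b : LinearMap.BilinForm ℝ V}
    (ha : IsInnerProduct a) (hb : IsInnerProduct b) (u : V) :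
    b u u ≤ Real.exp (dP e a b) * a u u := by
  obtain ⟨w, q, h, hq⟩ := ha.exists_diagonalizes e hb
  rw [h.right_eq_sum, h.left_eq_sum u u, Finset.mul_sum]
  refine Finset.sum_le_sum fun i _ => ?_
  rw [mul_assoc]
  refine mul_le_mul_of_nonneg_right ?_ (mul_self_nonneg _)
  rw [← Real.log_le_iff_le_exp (hq i), h.dP_eq e]
  refine Real.le_sqrt_of_sq_le ?_
  exact Finset.single_le_sum (f := fun i => Real.log (q i) ^ 2) (fun i _ => sq_nonneg _)
    (Finset.mem_univ i)

/-- Forms that differ at most by the factor `exp s` have distance at most `√k * s`. -/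
theorem dP_le_of_le_exp_mul (e : Module.Basis (Fin k) ℝ V) {a b : LinearMap.BilinForm ℝ V}
    (ha : IsInnerProduct a) (hb : IsInnerProduct b) {s : ℝ} (hs : 0 ≤ s)
    (h₁ : ∀ u, b u u ≤ Real.exp s * a u u) (h₂ : ∀ u, a u u ≤ Real.exp s * b u u) :
    dP e a b ≤ √k * s := by
  obtain ⟨w, q, h, hq⟩ := ha.exists_diagonalizes e hb
  rw [h.dP_eq e]
  have hlog : ∀ i, Real.log (q i) ^ 2 ≤ s ^ 2 := by
    intro i
    have h1 := h₁ (w i)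
    have h2 := h₂ (w i)
    rw [h.left, h.right, if_pos rfl, if_pos rfl] at h1 h2
    refine sq_le_sq' ?_ ?_
    · rw [neg_le, ← Real.log_inv, Real.log_le_iff_le_exp (inv_pos.2 (hq i)),
        inv_le_iff_one_le_mul₀ (hq i)]
      exact h2
    · rw [Real.log_le_iff_le_exp (hq i)]
      simpa using h1
  refine Real.sqrt_le_iff.2 ⟨by positivity, ?_⟩
  calc ∑ i, Real.log (q i) ^ 2 ≤ ∑ _i : Fin k, s ^ 2 := Finset.sum_le_sum fun i _ => hlog i
    _ = (√k * s) ^ 2 := by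
      rw [mul_pow, Real.sq_sqrt (by positivity)]
      simp

end Diagonalization

/-! ### The triangle inequality for the distance of inner products -/

section Triangle

/-- Second order Taylor estimate for `log²`, with a constant that is uniform on
`[exp (-R), exp R]`. -/
theorem log_sq_le_taylor {R p q : ℝ} (hR : 0 ≤ R) (hp : Real.exp (-R) ≤ p) (hp' : p ≤ Real.exp R)
    (hq : Real.exp (-R) ≤ q) :
    Real.log q ^ 2 ≤ Real.log p ^ 2 + 2 * Real.log p / p * (q - p) +
      (1 + 2 * R) * Real.exp R ^ 2 * (q - p) ^ 2 := by
  have hp0 : 0 < p := (Real.exp_pos _).trans_le hp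
  have hq0 : 0 < q := (Real.exp_pos _).trans_le hq
  set E := Real.exp R with hE
  have hE0 : 0 < E := Real.exp_pos _
  have hpi : p⁻¹ ≤ E := by
    rw [Real.exp_neg] at hp
    exact inv_le_of_inv_le₀ hE0 hp
  have hqi : q⁻¹ ≤ E := by
    rw [Real.exp_neg] at hq
    exact inv_le_of_inv_le₀ hE0 hq
  have hpi0 : 0 < p⁻¹ := inv_pos.2 hp0
  have hqi0 : 0 < q⁻¹ := inv_pos.2 hq0
  have hlp : |Real.log p| ≤ R := by
    rw [abs_le]
    exact ⟨(Real.le_log_iff_exp_le hp0).2 hp, (Real.log_le_iff_le_exp hp0).2 hp'⟩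
  set x := Real.log q - Real.log p with hx
  have hup : x ≤ (q - p) * p⁻¹ := by
    have := Real.log_le_sub_one_of_pos (div_pos hq0 hp0)
    rw [Real.log_div hq0.ne' hp0.ne'] at this
    calc x ≤ q / p - 1 := this
      _ = _ := by field_simp
  have hlow : (q - p) * q⁻¹ ≤ x := by
    have := Real.log_le_sub_one_of_pos (div_pos hp0 hq0)
    rw [Real.log_div hp0.ne' hq0.ne'] at this
    calc (q - p) * q⁻¹ = 1 - p / q := by field_simp
      _ ≤ x := by linarith
  have hx2 : x ^ 2 ≤ E ^ 2 * (q - p) ^ 2 := by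
    rw [← mul_pow]
    refine sq_le_sq.2 ?_
    rw [abs_mul, abs_of_pos hE0, abs_le]
    constructor
    · refine le_trans ?_ hlow
      have : -(|q - p| * q⁻¹) ≤ (q - p) * q⁻¹ := by
        rw [← neg_mul]
        exact mul_le_mul_of_nonneg_right (neg_abs_le _) hqi0.le
      nlinarith [abs_nonneg (q - p)]
    · refine hup.trans ?_
      have : (q - p) * p⁻¹ ≤ |q - p| * p⁻¹ :=
        mul_le_mul_of_nonneg_right (le_abs_self _) hpi0.le
      nlinarith [abs_nonneg (q - p)]
  have hr0 : 0 ≤ (q - p) * p⁻¹ - x := by linarith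
  have hr : (q - p) * p⁻¹ - x ≤ E ^ 2 * (q - p) ^ 2 := by
    have h1 : (q - p) * p⁻¹ - x ≤ (q - p) ^ 2 * (p⁻¹ * q⁻¹) := by
      have : (q - p) * p⁻¹ - (q - p) * q⁻¹ = (q - p) ^ 2 * (p⁻¹ * q⁻¹) := by
        field_simp
      linarith
    have h2 : p⁻¹ * q⁻¹ ≤ E ^ 2 := by
      rw [pow_two]
      exact mul_le_mul hpi hqi hqi0.le hE0.le
    nlinarith [sq_nonneg (q - p)]
  have hmain : -(2 * Real.log p) * ((q - p) * p⁻¹ - x) ≤ 2 * R * (E ^ 2 * (q - p) ^ 2) := by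
    have := neg_le_of_abs_le hlp
    calc -(2 * Real.log p) * ((q - p) * p⁻¹ - x) ≤ (2 * R) * ((q - p) * p⁻¹ - x) :=
          mul_le_mul_of_nonneg_right (by linarith) hr0
      _ ≤ _ := mul_le_mul_of_nonneg_left hr (by linarith)
  have hlq : Real.log q = Real.log p + x := by simp [hx]
  rw [hlq, div_eq_mul_inv]
  nlinarith

/-- If a step of length `h` increases `Φ` by at most `2 h √Φ L`, up to a uniform error of order `h²`,
then `√Φ` grows by at most `L` on the unit interval. -/
theorem sqrt_le_sqrt_add_of_step {Φ : ℝ → ℝ} {L C : ℝ} (hΦ : ∀ t, 0 ≤ Φ t) (hL : 0 ≤ L)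
    (hC : 0 ≤ C)
    (hstep : ∀ t h, 0 ≤ t → 0 ≤ h → t + h ≤ 1 → h * L ≤ 1 →
      Φ (t + h) ≤ Φ t + 2 * h * (√(Φ t) * L) + C * h ^ 2) :
    √(Φ 1) ≤ √(Φ 0) + L := by
  have main : ∀ δ : ℝ, 0 < δ → √(Φ 1) ≤ √(Φ 0) + δ + L := by
    intro δ hδ
    -- `δ²` is added to `Φ` to keep the square root away from zero.
    set ψ : ℝ → ℝ := fun t => √(Φ t + δ ^ 2) with hψ
    have hψδ : ∀ t, δ ≤ ψ t := fun t => Real.le_sqrt_of_sq_le (by linarith [hΦ t])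
    have hψΦ : ∀ t, √(Φ t) ≤ ψ t := fun t => Real.sqrt_le_sqrt (by nlinarith)
    have hstep' : ∀ t h, 0 ≤ t → 0 ≤ h → t + h ≤ 1 → h * L ≤ 1 →
        ψ (t + h) ≤ ψ t + (h * L + C / (2 * δ) * h ^ 2) := by
      intro t h ht hh hth hhL
      have hpos : 0 ≤ ψ t := hδ.le.trans (hψδ t)
      have hD : 0 ≤ C / (2 * δ) * h ^ 2 := by positivity
      refine Real.sqrt_le_iff.2 ⟨by positivity, ?_⟩
      have h1 := hstep t h ht hh hth hhL
      have h2 : ψ t ^ 2 = Φ t + δ ^ 2 := Real.sq_sqrt (by nlinarith [hΦ t])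
      have h3 : C * h ^ 2 ≤ 2 * ψ t * (C / (2 * δ) * h ^ 2) := by
        calc C * h ^ 2 = 2 * δ * (C / (2 * δ) * h ^ 2) := by field_simp
          _ ≤ _ := mul_le_mul_of_nonneg_right (by linarith [hψδ t]) hD
      have h4 : 2 * h * (√(Φ t) * L) ≤ 2 * ψ t * (h * L) := by
        have := mul_le_mul_of_nonneg_right (hψΦ t) (mul_nonneg hh hL)
        nlinarith
      nlinarith [sq_nonneg (h * L + C / (2 * δ) * h ^ 2)]
    have hn : ∀ n : ℕ, 0 < n → L ≤ n → ψ 1 ≤ ψ 0 + L + C / (2 * δ) * (n : ℝ)⁻¹ := by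
      intro n hn hLn
      have hn0 : (0 : ℝ) < n := by exact_mod_cast hn
      have hj : ∀ j : ℕ, j ≤ n →
          ψ (j * (n : ℝ)⁻¹) ≤ ψ 0 + j * ((n : ℝ)⁻¹ * L + C / (2 * δ) * (n : ℝ)⁻¹ ^ 2) := by
        intro j
        induction j with
        | zero => simp
        | succ j ih =>
          intro hj
          have h1 := ih (by omega)
          have hj' : (j : ℝ) + 1 ≤ n := by exact_mod_cast hj
          have h2 := hstep' (j * (n : ℝ)⁻¹) (n : ℝ)⁻¹ (by positivity) (by positivity)
            (by
              rw [← add_one_mul, ← div_eq_mul_inv]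
              exact (div_le_one hn0).2 hj')
            (by
              rw [inv_mul_le_iff₀ hn0]
              linarith)
          push_cast
          rw [add_one_mul]
          linarith
      have := hj n le_rfl
      rw [mul_inv_cancel₀ hn0.ne'] at this
      refine this.trans (le_of_eq ?_)
      field_simp
      ring
    have hlim : ψ 1 ≤ ψ 0 + L := by
      have ht : Filter.Tendsto (fun n : ℕ => ψ 0 + L + C / (2 * δ) * (n : ℝ)⁻¹) Filter.atTop
          (nhds (ψ 0 + L + C / (2 * δ) * 0)) :=
        (tendsto_inv_atTop_nhds_zero_nat.const_mul _).const_add _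
      rw [mul_zero, add_zero] at ht
      refine ge_of_tendsto ht ?_
      obtain ⟨N, hN⟩ := exists_nat_ge L
      filter_upwards [Filter.eventually_ge_atTop (max N 1)] with n hn'
      refine hn n (by omega) (hN.trans ?_)
      exact_mod_cast (le_max_left N 1).trans hn'
    have h0 : ψ 0 ≤ √(Φ 0) + δ := by
      refine Real.sqrt_le_iff.2 ⟨by positivity, ?_⟩
      nlinarith [Real.sq_sqrt (hΦ 0), Real.sqrt_nonneg (Φ 0)]
    linarith [hψΦ 1]
  refine le_of_forall_pos_le_add fun δ hδ => ?_
  linarith [main δ hδ]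

variable {k : ℕ} {V : Type*} [AddCommGroup V] [Module ℝ V]

namespace Diagonalizes

variable {a P Q : LinearMap.BilinForm ℝ V} {u w : Module.Basis (Fin k) ℝ V} {p q : Fin k → ℝ}

/-- Expansion of `d_P(a, Q)²` around `P`. In matrix notation with `a = 1`: the trace of `log² Q` is
at most the trace of `log² P` plus the first order term `tr (2 P⁻¹ log P (Q - P))`, up to a
quadratic error. Since the squared coefficients `a (u i) (w j) ^ 2` form a doubly stochastic
matrix, this reduces to the scalar Taylor estimate for each pair of eigenvalues. -/
theorem sum_log_sq_le (hu : Diagonalizes a P u p) (hw : Diagonalizes a Q w q)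
    (ha : IsInnerProduct a) {R : ℝ} (hR : 0 ≤ R)
    (hp : ∀ i, Real.exp (-R) ≤ p i) (hp' : ∀ i, p i ≤ Real.exp R)
    (hq : ∀ i, Real.exp (-R) ≤ q i) :
    ∑ j, Real.log (q j) ^ 2 ≤ ∑ i, Real.log (p i) ^ 2 +
      ∑ i, 2 * Real.log (p i) / p i * (Q (u i) (u i) - p i) +
      (1 + 2 * R) * Real.exp R ^ 2 * ∑ i, ∑ j, (Q (u i) (w j) - P (u i) (w j)) ^ 2 := by
  have hPsymm : ∀ i j, P (u i) (w j) = p i * a (u i) (w j) := by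
    intro i j
    rw [hu.right_eq_sum]
    simp [hu.left, ha.1 (w j)]
  have hrow : ∀ i, ∑ j, a (u i) (w j) ^ 2 = 1 := by
    intro i
    have := hw.left_eq_sum (u i) (u i)
    rw [hu.left, if_pos rfl] at this
    rw [this]
    exact Finset.sum_congr rfl fun j _ => pow_two _
  have hcol : ∀ j, ∑ i, a (u i) (w j) ^ 2 = 1 := by
    intro j
    have := hu.left_eq_sum (w j) (w j)
    rw [hw.left, if_pos rfl] at this
    rw [this]
    exact Finset.sum_congr rfl fun i _ => by rw [pow_two, ha.1 (w j)]
  have hQu : ∀ i, Q (u i) (u i) - p i = ∑ j, a (u i) (w j) ^ 2 * (q j - p i) := by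
    intro i
    rw [hw.right_eq_sum]
    simp_rw [mul_sub]
    rw [Finset.sum_sub_distrib, ← Finset.sum_mul, hrow, one_mul]
    congr 1
    exact Finset.sum_congr rfl fun j _ => by ring
  calc ∑ j, Real.log (q j) ^ 2 = ∑ j, ∑ i, a (u i) (w j) ^ 2 * Real.log (q j) ^ 2 := by
        refine Finset.sum_congr rfl fun j _ => ?_
        rw [← Finset.sum_mul, hcol, one_mul]
    _ = ∑ i, ∑ j, a (u i) (w j) ^ 2 * Real.log (q j) ^ 2 := Finset.sum_comm
    _ ≤ ∑ i, ∑ j, a (u i) (w j) ^ 2 * (Real.log (p i) ^ 2 +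
          2 * Real.log (p i) / p i * (q j - p i) +
          (1 + 2 * R) * Real.exp R ^ 2 * (q j - p i) ^ 2) :=
        Finset.sum_le_sum fun i _ => Finset.sum_le_sum fun j _ =>
          mul_le_mul_of_nonneg_left (log_sq_le_taylor hR (hp i) (hp' i) (hq j)) (sq_nonneg _)
    _ = _ := by
        rw [Finset.mul_sum, ← Finset.sum_add_distrib, ← Finset.sum_add_distrib]
        refine Finset.sum_congr rfl fun i _ => ?_
        rw [hQu, Finset.mul_sum, Finset.mul_sum]
        have h1 : Real.log (p i) ^ 2 = ∑ j, a (u i) (w j) ^ 2 * Real.log (p i) ^ 2 := by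
          rw [← Finset.sum_mul, hrow, one_mul]
        conv_rhs => rw [h1]
        rw [← Finset.sum_add_distrib, ← Finset.sum_add_distrib]
        refine Finset.sum_congr rfl fun j _ => ?_
        rw [hw.right_apply, hPsymm]
        ring

end Diagonalizes

/-- The geodesic of the space of inner products that starts at the inner product with orthonormal
basis `v` and has the velocity with eigenvalues `l` in that basis. -/
noncomputable def geodesic (v : Module.Basis (Fin k) ℝ V) (l : Fin k → ℝ) (t : ℝ) :
    LinearMap.BilinForm ℝ V :=
  ∑ i, Real.exp (t * l i) • LinearMap.BilinForm.linMulLin (v.coord i) (v.coord i)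

theorem geodesic_apply (v : Module.Basis (Fin k) ℝ V) (l : Fin k → ℝ) (t : ℝ) (u u' : V) :
    geodesic v l t u u' = ∑ i, Real.exp (t * l i) * (v.repr u i * v.repr u' i) := by
  simp [geodesic, LinearMap.sum_apply]

theorem geodesic_basis (v : Module.Basis (Fin k) ℝ V) (l : Fin k → ℝ) (t : ℝ) (i j : Fin k) :
    geodesic v l t (v i) (v j) = if i = j then Real.exp (t * l i) else 0 := by
  rw [geodesic_apply]
  by_cases h : i = j <;> simp [Finsupp.single_apply, h]

theorem geodesic_isInnerProduct (v : Module.Basis (Fin k) ℝ V) (l : Fin k → ℝ) (t : ℝ) :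
    IsInnerProduct (geodesic v l t) := by
  constructor
  · intro u u'
    simp [geodesic_apply, mul_comm]
  · intro u hu
    rw [geodesic_apply]
    have hne : ∃ i, v.repr u i ≠ 0 := by
      by_contra! h
      exact hu (v.repr.map_eq_zero_iff.1 (Finsupp.ext h))
    obtain ⟨i, hi⟩ := hne
    refine Finset.sum_pos' (fun j _ => ?_) ⟨i, Finset.mem_univ i, ?_⟩
    · have := mul_self_nonneg (v.repr u j)
      positivity
    · have := mul_self_pos.2 hi
      positivity

theorem abs_le_sqrt_sum_sq (l : Fin k → ℝ) (i : Fin k) : |l i| ≤ √(∑ i, l i ^ 2) :=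
  Real.abs_le_sqrt (Finset.single_le_sum (f := fun i => l i ^ 2) (fun _ _ => sq_nonneg _)
    (Finset.mem_univ i))

/-- The first variation of `d_P(a, ·)` along a geodesic is bounded by the speed of the geodesic. -/
theorem first_order_term_le {L R h t : ℝ} {v u : Module.Basis (Fin k) ℝ V} {l p : Fin k → ℝ}
    {a : LinearMap.BilinForm ℝ V} (hu : Diagonalizes a (geodesic v l t) u p)
    (hp : ∀ i, 0 < p i)
    (hl : ∀ i, |l i| ≤ L) (hh : 0 ≤ h) (hhL : h * L ≤ 1)
    (hpR : ∀ i, |Real.log (p i)| ≤ R) :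
    ∑ i, 2 * Real.log (p i) / p i * (geodesic v l (t + h) (u i) (u i) - p i) ≤
      2 * h * (√(∑ i, Real.log (p i) ^ 2) * √(∑ i, l i ^ 2)) + 2 * R * k * L ^ 2 * h ^ 2 := by
  set W : Fin k → Fin k → ℝ := fun i j => Real.exp (t * l j) * v.repr (u i) j ^ 2 / p i with hW
  have hW0 : ∀ i j, 0 ≤ W i j := fun i j => by
    have := hp i
    positivity
  -- `W` is doubly stochastic, as the matrix of squared coefficients between two bases that are
  -- orthonormal for `geodesic v l t`.
  have hrow : ∀ i, ∑ j, W i j = 1 := by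
    intro i
    have := hu.right i i
    rw [geodesic_apply, if_pos rfl] at this
    rw [hW]
    simp_rw [← Finset.sum_div, pow_two]
    rw [this, div_self (hp i).ne']
  have hcol : ∀ j, ∑ i, W i j = 1 := by
    intro j
    have h1 := hu.right_eq_sum (v j) (v j)
    rw [geodesic_basis, if_pos rfl] at h1
    have h2 : ∀ i, p i * a (v j) (u i) = Real.exp (t * l j) * v.repr (u i) j := by
      intro i
      rw [← hu.right_apply, geodesic_apply]
      simp [Finsupp.single_apply]
    have hE := Real.exp_pos (t * l j)
    refine mul_left_cancel₀ hE.ne' ?_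
    rw [mul_one]
    conv_rhs => rw [h1]
    rw [Finset.mul_sum]
    refine Finset.sum_congr rfl fun i _ => ?_
    have hpi := (hp i).ne'
    have h3 : a (v j) (u i) = Real.exp (t * l j) * v.repr (u i) j / p i := by
      rw [← h2 i]
      field_simp
    rw [h3, hW]
    field_simp
  have hρ : ∀ j, |Real.exp (h * l j) - 1 - h * l j| ≤ L ^ 2 * h ^ 2 := by
    intro j
    have habs : |h * l j| ≤ h * L := by
      rw [abs_mul, abs_of_nonneg hh]
      exact mul_le_mul_of_nonneg_left (hl j) hh
    refine (Real.abs_exp_sub_one_sub_id_le (habs.trans hhL)).trans ?_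
    rw [← sq_abs, ← mul_pow, mul_comm L h]
    exact pow_le_pow_left₀ (abs_nonneg _) habs 2
  have hexp : ∀ i, 2 * Real.log (p i) / p i * (geodesic v l (t + h) (u i) (u i) - p i) =
      ∑ j, (2 * h * (W i j * (Real.log (p i) * l j)) +
        2 * (W i j * (Real.log (p i) * (Real.exp (h * l j) - 1 - h * l j)))) := by
    intro i
    have h1 := hu.right i i
    rw [if_pos rfl] at h1
    nth_rewrite 3 [← h1]
    rw [geodesic_apply, geodesic_apply, ← Finset.sum_sub_distrib, Finset.mul_sum]
    refine Finset.sum_congr rfl fun j _ => ?_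
    rw [add_mul, Real.exp_add]
    simp only [hW]
    field_simp
    ring
  have hsum : ∀ f : Fin k → ℝ, ∑ i, ∑ j, W i j * f i = ∑ i, f i := by
    intro f
    refine Finset.sum_congr rfl fun i _ => ?_
    rw [← Finset.sum_mul, hrow, one_mul]
  have hsum' : ∀ f : Fin k → ℝ, ∑ i, ∑ j, W i j * f j = ∑ i, f i := by
    intro f
    rw [Finset.sum_comm]
    refine Finset.sum_congr rfl fun i _ => ?_
    rw [← Finset.sum_mul, hcol, one_mul]
  have hCS : ∑ i, ∑ j, W i j * (Real.log (p i) * l j) ≤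
      √(∑ i, Real.log (p i) ^ 2) * √(∑ i, l i ^ 2) := by
    rw [← hsum (fun i => Real.log (p i) ^ 2), ← hsum' (fun i => l i ^ 2)]
    simp_rw [← Fintype.sum_prod_type']
    have := Real.sum_mul_le_sqrt_mul_sqrt Finset.univ
      (fun x : Fin k × Fin k => √(W x.1 x.2) * Real.log (p x.1))
      (fun x : Fin k × Fin k => √(W x.1 x.2) * l x.2)
    simp only [mul_pow, Real.sq_sqrt (hW0 _ _)] at this
    refine le_trans (le_of_eq ?_) this
    refine Finset.sum_congr rfl fun x _ => ?_
    calc W x.1 x.2 * (Real.log (p x.1) * l x.2)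
        = (√(W x.1 x.2) * √(W x.1 x.2)) * (Real.log (p x.1) * l x.2) := by
          rw [Real.mul_self_sqrt (hW0 _ _)]
      _ = _ := by ring
  have hrem : ∑ i, ∑ j, W i j * (Real.log (p i) * (Real.exp (h * l j) - 1 - h * l j)) ≤
      R * k * L ^ 2 * h ^ 2 := by
    calc _ ≤ ∑ i : Fin k, ∑ j, W i j * (R * (L ^ 2 * h ^ 2)) := by
          refine Finset.sum_le_sum fun i _ => Finset.sum_le_sum fun j _ => ?_
          refine mul_le_mul_of_nonneg_left ?_ (hW0 i j)
          refine (le_abs_self _).trans ?_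
          rw [abs_mul]
          exact mul_le_mul (hpR i) (hρ j) (abs_nonneg _) ((abs_nonneg _).trans (hpR i))
      _ = ∑ i : Fin k, R * (L ^ 2 * h ^ 2) := hsum fun _ => R * (L ^ 2 * h ^ 2)
      _ = _ := by
          simp
          ring
  simp_rw [hexp, Finset.sum_add_distrib, ← Finset.mul_sum]
  nlinarith

/-- Geodesics are Lipschitz in time, uniformly on bounded sets of vectors. -/
theorem abs_geodesic_sub_le {L S h t : ℝ} {v : Module.Basis (Fin k) ℝ V} {l : Fin k → ℝ}
    (hL : 0 ≤ L) (hl : ∀ i, |l i| ≤ L) (ht : 0 ≤ t) (ht' : t ≤ 1) (hh : 0 ≤ h) (hhL : h * L ≤ 1) {x y : V}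
    (hx : ∑ i, v.repr x i ^ 2 ≤ S) (hy : ∑ i, v.repr y i ^ 2 ≤ S) :
    |geodesic v l (t + h) x y - geodesic v l t x y| ≤ Real.exp L * (2 * (h * L)) * S := by
  rw [geodesic_apply, geodesic_apply, ← Finset.sum_sub_distrib]
  refine (Finset.abs_sum_le_sum_abs _ _).trans ?_
  calc _ ≤ ∑ i, Real.exp L * (2 * (h * L)) * ((v.repr x i ^ 2 + v.repr y i ^ 2) / 2) := by
        refine Finset.sum_le_sum fun i _ => ?_
        rw [add_mul, Real.exp_add]
        have h1 : Real.exp (t * l i) * Real.exp (h * l i) * (v.repr x i * v.repr y i) -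
            Real.exp (t * l i) * (v.repr x i * v.repr y i) =
            Real.exp (t * l i) * (Real.exp (h * l i) - 1) * (v.repr x i * v.repr y i) := by ring
        rw [h1, abs_mul, abs_mul, Real.abs_exp]
        have habs : |h * l i| ≤ h * L := by
          rw [abs_mul, abs_of_nonneg hh]
          exact mul_le_mul_of_nonneg_left (hl i) hh
        have h2 : Real.exp (t * l i) ≤ Real.exp L := by
          refine Real.exp_le_exp.2 ((le_abs_self _).trans ?_)
          rw [abs_mul, abs_of_nonneg ht]
          calc t * |l i| ≤ 1 * |l i| := mul_le_mul_of_nonneg_right ht' (abs_nonneg _)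
            _ ≤ L := by rw [one_mul]; exact hl i
        have h3 : |Real.exp (h * l i) - 1| ≤ 2 * (h * L) :=
          (Real.abs_exp_sub_one_le (habs.trans hhL)).trans (by linarith)
        have h4 : |v.repr x i * v.repr y i| ≤ (v.repr x i ^ 2 + v.repr y i ^ 2) / 2 := by
          rw [abs_le]
          constructor <;> nlinarith [sq_nonneg (v.repr x i + v.repr y i),
            sq_nonneg (v.repr x i - v.repr y i)]
        exact mul_le_mul (mul_le_mul h2 h3 (abs_nonneg _) (Real.exp_pos _).le) h4 (abs_nonneg _)
          (by positivity)
    _ = Real.exp L * (2 * (h * L)) *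
          ((∑ i, v.repr x i ^ 2 + ∑ i, v.repr y i ^ 2) / 2) := by
        rw [← Finset.mul_sum, ← Finset.sum_div, Finset.sum_add_distrib]
    _ ≤ _ := mul_le_mul_of_nonneg_left (by linarith) (by positivity)

theorem geodesic_diagonalizes {a b : LinearMap.BilinForm ℝ V} {v : Module.Basis (Fin k) ℝ V}
    {q : Fin k → ℝ} (h : Diagonalizes a b v q) (l : Fin k → ℝ) (t : ℝ) :
    Diagonalizes a (geodesic v l t) v fun i => Real.exp (t * l i) :=
  ⟨h.left, geodesic_basis v l t⟩

/-- The distance `d_P` satisfies the triangle inequality: along the geodesic from `b` to `c`, the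
distance to `a` grows at most with the speed `d_P(b, c)` of the geodesic. -/
theorem dP_triangle (e : Module.Basis (Fin k) ℝ V) {a b c : LinearMap.BilinForm ℝ V}
    (ha : IsInnerProduct a) (hb : IsInnerProduct b) (hc : IsInnerProduct c) :
    dP e a c ≤ dP e a b + dP e b c := by
  obtain ⟨v, q, hv, hq⟩ := hb.exists_diagonalizes e hc
  set l : Fin k → ℝ := fun i => Real.log (q i) with hl
  -- `M` runs from `b` to `c` and has speed `L = d_P(b, c)`; it stays in the set of inner products
  -- between `exp (-R) • a` and `exp R • a`, on which the error terms are uniform.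
  set M := geodesic v l with hM
  have hMi : ∀ t, IsInnerProduct (M t) := geodesic_isInnerProduct v l
  have hM0 : M 0 = b := by
    refine LinearMap.ext₂ fun x y => ?_
    rw [hM, geodesic_apply, hv.left_eq_sum]
    simp [hv.repr_eq]
  have hM1 : M 1 = c := by
    refine LinearMap.ext₂ fun x y => ?_
    rw [hM, geodesic_apply, hv.right_eq_sum]
    simp [hv.repr_eq, hl, Real.exp_log (hq _), mul_assoc]
  set L := √(∑ i, l i ^ 2) with hLdef
  have hL : 0 ≤ L := Real.sqrt_nonneg _
  have hbc : dP e b c = L := hv.dP_eq e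
  set R := dP e a b + L with hRdef
  have hR : 0 ≤ R := add_nonneg (dP_nonneg e a b) hL
  have hdist : ∀ t, 0 ≤ t → t ≤ 1 → dP e b (M t) ≤ L := by
    intro t ht ht'
    rw [(geodesic_diagonalizes hv l t).dP_eq e]
    refine Real.sqrt_le_sqrt (Finset.sum_le_sum fun i _ => ?_)
    rw [Real.log_exp, mul_pow]
    exact mul_le_of_le_one_left (sq_nonneg _) (pow_le_one₀ ht ht')
  have hup : ∀ t, 0 ≤ t → t ≤ 1 → ∀ x, M t x x ≤ Real.exp R * a x x := by
    intro t ht ht' x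
    calc M t x x ≤ Real.exp (dP e b (M t)) * b x x := le_exp_dP_mul e hb (hMi t) x
      _ ≤ Real.exp L * b x x :=
        mul_le_mul_of_nonneg_right (Real.exp_le_exp.2 (hdist t ht ht')) (hb.nonneg x)
      _ ≤ Real.exp L * (Real.exp (dP e a b) * a x x) :=
        mul_le_mul_of_nonneg_left (le_exp_dP_mul e ha hb x) (Real.exp_pos _).le
      _ = _ := by
        rw [hRdef, Real.exp_add]
        ring
  have hlow : ∀ t, 0 ≤ t → t ≤ 1 → ∀ x, a x x ≤ Real.exp R * M t x x := by
    intro t ht ht' x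
    calc a x x ≤ Real.exp (dP e b a) * b x x := le_exp_dP_mul e hb ha x
      _ ≤ Real.exp (dP e b a) * (Real.exp (dP e (M t) b) * M t x x) :=
        mul_le_mul_of_nonneg_left (le_exp_dP_mul e (hMi t) hb x) (Real.exp_pos _).le
      _ ≤ Real.exp (dP e b a) * (Real.exp L * M t x x) := by
        refine mul_le_mul_of_nonneg_left (mul_le_mul_of_nonneg_right (Real.exp_le_exp.2 ?_)
          ((hMi t).nonneg x)) (Real.exp_pos _).le
        rw [dP_comm e (hMi t) hb]
        exact hdist t ht ht'
      _ = _ := by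
        rw [hRdef, Real.exp_add, dP_comm e hb ha]
        ring
  have hSb : ∀ {w : Module.Basis (Fin k) ℝ V} {Q : LinearMap.BilinForm ℝ V} {p : Fin k → ℝ},
      Diagonalizes a Q w p → ∀ i, ∑ j, v.repr (w i) j ^ 2 ≤ Real.exp R := by
    intro w Q p hw i
    have h1 := hup 0 le_rfl zero_le_one (w i)
    rw [hM, geodesic_apply, hw.left, if_pos rfl, mul_one] at h1
    simpa [pow_two] using h1
  have hpb : ∀ {t}, 0 ≤ t → t ≤ 1 → ∀ {w : Module.Basis (Fin k) ℝ V} {p : Fin k → ℝ},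
      Diagonalizes a (M t) w p → ∀ i, Real.exp (-R) ≤ p i ∧ p i ≤ Real.exp R := by
    intro t ht ht' w p hw i
    have h1 := hup t ht ht' (w i)
    have h2 := hlow t ht ht' (w i)
    rw [hw.left, hw.right, if_pos rfl, if_pos rfl] at h1 h2
    refine ⟨?_, by simpa using h1⟩
    rw [Real.exp_neg]
    exact inv_le_of_inv_le₀ (by nlinarith [Real.exp_pos R])
      ((inv_le_iff_one_le_mul₀ (by nlinarith [Real.exp_pos R])).2 h2)
  set C := 2 * R * k * L ^ 2 +
    (1 + 2 * R) * Real.exp R ^ 2 * (k * (k * (Real.exp L * (2 * L) * Real.exp R) ^ 2)) with hC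
  have hmain := sqrt_le_sqrt_add_of_step (Φ := fun t => dP e a (M t) ^ 2) (L := L) (C := C)
    (fun t => sq_nonneg _) hL (by positivity) ?_
  · simpa only [Real.sqrt_sq (dP_nonneg e a _), hM0, hM1, hbc] using hmain
  intro t h ht hh hth hhL
  have ht1 : t ≤ 1 := by linarith
  obtain ⟨u, p, hu, hp⟩ := ha.exists_diagonalizes e (hMi t)
  obtain ⟨w, q', hw, hq'⟩ := ha.exists_diagonalizes e (hMi (t + h))
  have hpR := hpb ht ht1 hu
  have hqR := hpb (add_nonneg ht hh) hth hw
  have hA := hu.sum_log_sq_le hw ha hR (fun i => (hpR i).1) (fun i => (hpR i).2)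
    fun i => (hqR i).1
  have hB := first_order_term_le hu hp (abs_le_sqrt_sum_sq l) hh hhL (R := R) (by
    intro i
    rw [abs_le]
    exact ⟨(Real.le_log_iff_exp_le (hp i)).2 (hpR i).1,
      (Real.log_le_iff_le_exp (hp i)).2 (hpR i).2⟩)
  have hD : ∑ i, ∑ j, (M (t + h) (u i) (w j) - M t (u i) (w j)) ^ 2 ≤
      k * (k * (Real.exp L * (2 * L) * Real.exp R) ^ 2) * h ^ 2 := by
    calc _ ≤ ∑ i : Fin k, ∑ j : Fin k, (Real.exp L * (2 * (h * L)) * Real.exp R) ^ 2 := by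
          refine Finset.sum_le_sum fun i _ => Finset.sum_le_sum fun j _ => ?_
          rw [← sq_abs]
          exact pow_le_pow_left₀ (abs_nonneg _) (abs_geodesic_sub_le hL (abs_le_sqrt_sum_sq l) ht
            ht1 hh hhL (hSb hu i) (hSb hw j)) 2
      _ = _ := by
          simp
          ring
  have hE : (1 + 2 * R) * Real.exp R ^ 2 *
      ∑ i, ∑ j, (M (t + h) (u i) (w j) - M t (u i) (w j)) ^ 2 ≤ (1 + 2 * R) * Real.exp R ^ 2 *
      (k * (k * (Real.exp L * (2 * L) * Real.exp R) ^ 2) * h ^ 2) :=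
    mul_le_mul_of_nonneg_left hD (by positivity)
  have hΦ : ∀ {Q : LinearMap.BilinForm ℝ V} {w : Module.Basis (Fin k) ℝ V} {p : Fin k → ℝ},
      Diagonalizes a Q w p → dP e a Q ^ 2 = ∑ i, Real.log (p i) ^ 2 := fun hw => by
    rw [hw.dP_eq e, Real.sq_sqrt (Finset.sum_nonneg fun i _ => sq_nonneg _)]
  simp only [hΦ hw, hΦ hu]
  refine (hA.trans (add_le_add (add_le_add_right hB _) hE)).trans (le_of_eq ?_)
  rw [hC]
  ring

end Triangle

/-! ### Coordinate vector fields and the null sets of the Riemannian volume -/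

section Charts

variable {k : ℕ} {H : Type*} [TopologicalSpace H]
  (I : ModelWithCorners ℝ (EuclideanSpace ℝ (Fin k)) H)
  {M : Type*} [TopologicalSpace M] [ChartedSpace H M]

theorem measurableSet_extChartAt_target (x₀ : M) : MeasurableSet (extChartAt I x₀).target := by
  rw [extChartAt_target]
  exact (((chartAt H x₀).open_target.preimage I.continuous_symm).measurableSet).inter
    I.isClosed_range.measurableSet

/-- The boundary points in the target of an extended chart form a null set: they lie on the
frontier of the range of the model, which is convex. -/
theorem ae_mem_interior_extChartAt_target (x₀ : M) :
    ∀ᵐ y ∂(volume.restrict (extChartAt I x₀).target), y ∈ interior (extChartAt I x₀).target := by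
  rw [ae_restrict_iff' (measurableSet_extChartAt_target I x₀)]
  have hconv : Convex ℝ (range I) := I.convex_range
  have hnull : volume (frontier (range I)) = 0 := hconv.addHaar_frontier volume
  have hae : ∀ᵐ y, y ∉ frontier (range I) := measure_eq_zero_iff_ae_notMem.1 hnull
  filter_upwards [hae] with y hy hyt
  rw [extChartAt_target] at hyt ⊢
  rw [interior_inter, ((chartAt H x₀).open_target.preimage I.continuous_symm).interior_eq]
  refine ⟨hyt.1, ?_⟩
  by_contra h
  exact hy ⟨subset_closure hyt.2, h⟩

theorem continuousOn_chartInv (x₀ : M) : ContinuousOn (chartInv I x₀) (extChartAt I x₀).target :=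
  continuousOn_extChartAt_symm x₀

theorem aemeasurable_chartInv [MeasurableSpace M] [BorelSpace M] (x₀ : M) :
    AEMeasurable (chartInv I x₀) (volume.restrict (extChartAt I x₀).target) :=
  (continuousOn_chartInv I x₀).aemeasurable (measurableSet_extChartAt_target I x₀)

variable [IsManifold I ∞ M]

theorem exists_basis_coordVector {x₀ : M} {y : EuclideanSpace ℝ (Fin k)}
    (hy : y ∈ (extChartAt I x₀).target) :
    ∃ v : Module.Basis (Fin k) ℝ (TangentSpace I (chartInv I x₀ y)),
      ∀ i, v i = coordVector I x₀ y i := by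
  have : IsManifold I 1 M := IsManifold.of_le (n := ∞) (by simp)
  obtain ⟨A, hA⟩ := isInvertible_mfderivWithin_extChartAt_symm (I := I) hy
  let A' : EuclideanSpace ℝ (Fin k) ≃ₗ[ℝ] TangentSpace I (chartInv I x₀ y) := A.toLinearEquiv
  refine ⟨(EuclideanSpace.basisFun (Fin k) ℝ).toBasis.map A', fun i => ?_⟩
  rw [Module.Basis.map_apply, OrthonormalBasis.coe_toBasis, EuclideanSpace.basisFun_apply]
  exact congrArg (fun B => B (EuclideanSpace.single i (1 : ℝ) : EuclideanSpace ℝ (Fin k))) hA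

theorem continuousOn_coordVector (x₀ : M) (i : Fin k) :
    ContinuousOn (fun y => (⟨chartInv I x₀ y, coordVector I x₀ y i⟩ : TangentBundle I M))
      (extChartAt I x₀).target := by
  have : IsManifold I 1 M := IsManifold.of_le (n := ∞) (by simp)
  have hs : UniqueMDiffOn 𝓘(ℝ, EuclideanSpace ℝ (Fin k)) (extChartAt I x₀).target :=
    (uniqueDiffOn_extChartAt_target x₀).uniqueMDiffOn
  have h1 := (contMDiffOn_extChartAt_symm (I := I) (n := 1) x₀).continuousOn_tangentMapWithin
    le_rfl hs
  have h2 : Continuous fun y : EuclideanSpace ℝ (Fin k) =>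
      (⟨y, (EuclideanSpace.single i (1 : ℝ) : EuclideanSpace ℝ (Fin k))⟩ :
        TangentBundle 𝓘(ℝ, EuclideanSpace ℝ (Fin k)) (EuclideanSpace ℝ (Fin k))) :=
    (tangentBundleModelSpaceHomeomorph 𝓘(ℝ, EuclideanSpace ℝ (Fin k))).symm.continuous.comp
      (continuous_id.prodMk continuous_const)
  refine (h1.comp h2.continuousOn (fun y hy => hy)).congr fun y hy => ?_
  have h3 : mfderivWithin 𝓘(ℝ, EuclideanSpace ℝ (Fin k)) I (chartInv I x₀)
      (extChartAt I x₀).target y =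
      mfderivWithin 𝓘(ℝ, EuclideanSpace ℝ (Fin k)) I (chartInv I x₀) (range I) y :=
    (mdifferentiableWithinAt_extChartAt_symm hy).mfderivWithin_mono (hs y hy)
      (extChartAt_target_subset_range x₀)
  simp only [Function.comp, tangentMapWithin, coordVector]
  rw [← h3]
  rfl

variable {I}
variable (g : Bundle.ContMDiffRiemannianMetric I ∞ (EuclideanSpace ℝ (Fin k))
    (fun x : M => TangentSpace I x))

theorem metricForm_isInnerProduct (x : M) : IsInnerProduct (metricForm g x) :=
  ⟨fun u v => g.symm x u v, fun v hv => g.pos x v hv⟩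

theorem continuousOn_metricForm_coordVector (x₀ : M) (i j : Fin k) :
    ContinuousOn (fun y => metricForm g (chartInv I x₀ y) (coordVector I x₀ y i)
      (coordVector I x₀ y j)) (extChartAt I x₀).target := by
  intro y hy
  have hg := g.contMDiff.continuous.continuousAt.comp_continuousWithinAt
    (continuousOn_chartInv I x₀ y hy)
  have h : ContinuousWithinAt (fun y => Bundle.TotalSpace.mk' ℝ (E := Bundle.Trivial M ℝ)
      (chartInv I x₀ y) (g.inner (chartInv I x₀ y) (coordVector I x₀ y i) (coordVector I x₀ y j)))
      (extChartAt I x₀).target y :=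
    hg.clm_bundle_apply₂ (F₁ := EuclideanSpace ℝ (Fin k)) (F₂ := EuclideanSpace ℝ (Fin k))
      (continuousOn_coordVector I x₀ i y hy) (continuousOn_coordVector I x₀ j y hy)
  simp only [FiberBundle.continuousWithinAt_totalSpace] at h
  exact h.2

theorem IsInnerProduct.det_gram_pos {V : Type*} [AddCommGroup V] [Module ℝ V]
    {b : LinearMap.BilinForm ℝ V} (hb : IsInnerProduct b) (v : Module.Basis (Fin k) ℝ V) :
    0 < (Matrix.of fun i j => b (v i) (v j)).det := by
  obtain ⟨w, hw⟩ := hb.exists_orthonormal v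
  have hw1 : LinearMap.BilinForm.toMatrix w b = 1 := by
    ext i j
    simp [LinearMap.BilinForm.toMatrix_apply, hw, Matrix.one_apply]
  have hv : (Matrix.of fun i j => b (v i) (v j)) = LinearMap.BilinForm.toMatrix v b := by
    ext i j
    simp [LinearMap.BilinForm.toMatrix_apply]
  rw [hv, ← LinearMap.BilinForm.toMatrix_mul_basis_toMatrix w v b, hw1, mul_one, Matrix.det_mul,
    Matrix.det_transpose]
  refine mul_self_pos.2 ?_
  have := w.invertibleToMatrix v
  exact (Matrix.isUnit_det_of_invertible (w.toMatrix v)).ne_zero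

section Volume

variable [MeasurableSpace M] [BorelSpace M]

/-- A property that holds almost everywhere for the Riemannian volume holds at almost all points of
every chart. -/
theorem ae_chartInv_of_ae_vol {P : M → Prop} (h : ∀ᵐ x ∂vol g, P x) (x₀ : M) :
    ∀ᵐ y ∂(volume.restrict (extChartAt I x₀).target), P (chartInv I x₀ y) := by
  have h1 : ∀ᵐ x ∂chartVol g x₀, P x :=
    (Measure.absolutelyContinuous_of_le (le_iSup (chartVol g) x₀)).ae_le h
  have h2 := ae_of_ae_map ((aemeasurable_chartInv I x₀).mono_ac
    (withDensity_absolutelyContinuous _ _)) h1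
  refine (withDensity_absolutelyContinuous' ?_ ?_).ae_le h2
  · have hdet : ContinuousOn (fun y => Matrix.det (Matrix.of fun i j : Fin k =>
        metricForm g (chartInv I x₀ y) (coordVector I x₀ y i) (coordVector I x₀ y j)))
        (extChartAt I x₀).target := by
      simp only [Matrix.det_apply, Matrix.of_apply]
      refine continuousOn_finsetSum _ fun σ _ => ContinuousOn.const_smul ?_ _
      exact continuousOn_finsetProd _ fun i _ => continuousOn_metricForm_coordVector g x₀ _ _
    exact ((hdet.aemeasurable (measurableSet_extChartAt_target I x₀)).sqrt).ennreal_ofReal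
  · filter_upwards [ae_restrict_mem (measurableSet_extChartAt_target I x₀)] with y hy
    obtain ⟨v, hv⟩ := exists_basis_coordVector I hy
    have := (metricForm_isInnerProduct g (chartInv I x₀ y)).det_gram_pos v
    simp only [hv] at this
    simpa using this

/-- Null sets of one chart are null sets for the volume, as they are so in the other charts. -/
theorem vol_image_chartInv_eq_zero {x₀ : M} {Z : Set (EuclideanSpace ℝ (Fin k))}
    (hZt : Z ⊆ (extChartAt I x₀).target) (hZ : MeasurableSet Z) (hZ0 : volume Z = 0) :
    vol g (chartInv I x₀ '' Z) = 0 := by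
  set W := chartInv I x₀ '' Z
  have hWeq : W = (extChartAt I x₀).source ∩ extChartAt I x₀ ⁻¹' Z := by
    ext x
    constructor
    · rintro ⟨z, hz, rfl⟩
      refine ⟨(extChartAt I x₀).map_target (hZt hz), ?_⟩
      change extChartAt I x₀ ((extChartAt I x₀).symm z) ∈ Z
      rwa [(extChartAt I x₀).right_inv (hZt hz)]
    · rintro ⟨hx, hxZ⟩
      exact ⟨_, hxZ, (extChartAt I x₀).left_inv hx⟩
  have hW : MeasurableSet W := by
    rw [hWeq]
    have hs : MeasurableSet (extChartAt I x₀).source := (isOpen_extChartAt_source x₀).measurableSet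
    have hc := (continuousOn_extChartAt (I := I) x₀).domRestrict
    have := hs.subtype_image (hc.measurable hZ)
    convert this using 1
    ext x
    simp [and_comm]
  have hchart : ∀ x₁, chartVol g x₁ W = 0 := by
    intro x₁
    rw [chartVol, Measure.map_apply_of_aemeasurable ((aemeasurable_chartInv I x₁).mono_ac
      (withDensity_absolutelyContinuous _ _)) hW]
    refine withDensity_absolutelyContinuous _ _ ?_
    rw [Measure.restrict_apply₀' (measurableSet_extChartAt_target I x₁).nullMeasurableSet]
    set D := ((extChartAt I x₀).symm ≫ extChartAt I x₁).source with hD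
    have hdiff : DifferentiableOn ℝ (extChartAt I x₁ ∘ (extChartAt I x₀).symm) (Z ∩ D) :=
      ((contDiffOn_ext_coord_change (n := ∞) x₁ x₀).differentiableOn (by simp)).mono
        inter_subset_right
    refine measure_mono_null ?_ (addHaar_image_eq_zero_of_differentiableOn_of_addHaar_eq_zero
      volume hdiff (measure_mono_null inter_subset_left hZ0))
    rintro y ⟨⟨z, hz, hzy⟩, hy⟩
    have hzy' : (extChartAt I x₀).symm z = (extChartAt I x₁).symm y := hzy
    refine ⟨z, ⟨hz, ?_⟩, ?_⟩
    · rw [hD, PartialEquiv.trans_source]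
      refine ⟨hZt hz, ?_⟩
      rw [mem_preimage, hzy']
      exact (extChartAt I x₁).map_target hy
    · rw [Function.comp_apply, hzy', (extChartAt I x₁).right_inv hy]
  -- The restriction of `vol g` to the complement of `W` bounds all `chartVol g x₁`, hence `vol g`.
  have hle : vol g ≤ (vol g).restrict Wᶜ := by
    refine iSup_le fun x₁ => ?_
    have h1 : (chartVol g x₁).restrict Wᶜ = chartVol g x₁ :=
      Measure.restrict_eq_self_of_ae_mem (measure_eq_zero_iff_ae_notMem.1 (hchart x₁))
    rw [← h1]
    exact Measure.restrict_mono le_rfl (le_iSup (chartVol g) x₁)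
  have := hle W
  rw [Measure.restrict_apply hW] at this
  simpa using this

/-- A property that holds at almost all points of every chart holds almost everywhere for the
Riemannian volume, since finitely many charts cover the compact manifold. -/
theorem ae_vol_of_ae_chartInv [CompactSpace M] {P : M → Prop}
    (h : ∀ x₀ : M, ∀ᵐ y ∂(volume.restrict (extChartAt I x₀).target), P (chartInv I x₀ y)) :
    ∀ᵐ x ∂vol g, P x := by
  obtain ⟨t, ht⟩ := isCompact_univ.elim_finite_subcover (fun x₀ : M => (extChartAt I x₀).source)
    (fun x₀ => isOpen_extChartAt_source x₀)
    fun x _ => mem_iUnion.2 ⟨x, mem_extChartAt_source x⟩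
  rw [ae_iff]
  have hnull : ∀ x₀ : M, vol g ({x | ¬P x} ∩ (extChartAt I x₀).source) = 0 := by
    intro x₀
    have h0 := h x₀
    rw [ae_iff] at h0
    set N := {y | ¬P (chartInv I x₀ y)}
    obtain ⟨Z, hNZ, hZ, hZ0⟩ := exists_measurable_superset_of_null h0
    have hT := measurableSet_extChartAt_target I x₀
    refine measure_mono_null ?_ (vol_image_chartInv_eq_zero g (x₀ := x₀)
      (Z := Z ∩ (extChartAt I x₀).target) inter_subset_right (hZ.inter hT) ?_)
    · rintro x ⟨hx, hxs⟩
      refine ⟨extChartAt I x₀ x, ⟨hNZ ?_, (extChartAt I x₀).map_source hxs⟩,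
        (extChartAt I x₀).left_inv hxs⟩
      change ¬P ((extChartAt I x₀).symm (extChartAt I x₀ x))
      rwa [(extChartAt I x₀).left_inv hxs]
    · rwa [Measure.restrict_apply hZ] at hZ0
  refine measure_mono_null (t := ⋃ x₀ ∈ t, {x | ¬P x} ∩ (extChartAt I x₀).source) ?_ ?_
  · intro x hx
    obtain ⟨x₀, hx₀, hxs⟩ := mem_iUnion₂.1 (ht (mem_univ x))
    exact mem_iUnion₂.2 ⟨x₀, hx₀, hx, hxs⟩
  · exact (measure_biUnion_null_iff t.countable_toSet).2 fun x₀ _ => hnull x₀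

end Volume

end Charts

/-! ### Uniqueness and closedness of weak differentials -/

section TestFunctions

variable {E F : Type*} [NormedAddCommGroup E] [MeasurableSpace E] [BorelSpace E] {μ : Measure E}
  [NormedAddCommGroup F] [NormedSpace ℝ F]

theorem integrable_smul_of_tsupport_subset {U : Set E} {f : E → F}
    (hf : LocallyIntegrableOn f U μ) {φ : E → ℝ} (hφ : Continuous φ) (hφc : HasCompactSupport φ)
    (hφU : tsupport φ ⊆ U) : Integrable (fun y => φ y • f y) μ := by
  have h1 : IntegrableOn (fun y => φ y • f y) (tsupport φ) μ :=
    (hf.integrableOn_compact_subset hφU hφc).continuousOn_smul hφ.continuousOn hφc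
  refine (integrableOn_iff_integrable_of_support_subset ?_).1 h1
  intro y hy
  refine subset_tsupport _ ?_
  intro h
  exact hy (by simp [h])

variable [NormedSpace ℝ E] [FiniteDimensional ℝ E]

/-- Almost everywhere limits under a continuous bound are locally integrable, and integrals against
test functions converge. -/
theorem locallyIntegrableOn_of_tendsto [IsLocallyFiniteMeasure μ] {U : Set E} (hU : IsOpen U)
    {h : ℕ → E → F} {h' : E → F} {B : E → ℝ} (hB : ContinuousOn B U)
    (hint : ∀ n, LocallyIntegrableOn (h n) U μ)
    (hbound : ∀ n, ∀ᵐ y ∂(μ.restrict U), ‖h n y‖ ≤ B y)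
    (hlim : ∀ᵐ y ∂(μ.restrict U), Filter.Tendsto (fun n => h n y) Filter.atTop (nhds (h' y))) :
    LocallyIntegrableOn h' U μ ∧
      ∀ φ : E → ℝ, Continuous φ → HasCompactSupport φ → tsupport φ ⊆ U →
        Filter.Tendsto (fun n => ∫ y, φ y • h n y ∂μ) Filter.atTop
          (nhds (∫ y, φ y • h' y ∂μ)) := by
  have hBloc : LocallyIntegrableOn B U μ := hB.locallyIntegrableOn hU.measurableSet
  have hmeas : AEStronglyMeasurable h' (μ.restrict U) :=
    aestronglyMeasurable_of_tendsto_ae _ (fun n => (hint n).aestronglyMeasurable) hlim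
  have hbound' : ∀ᵐ y ∂(μ.restrict U), ‖h' y‖ ≤ B y := by
    filter_upwards [hlim, ae_all_iff.2 hbound] with y hy hy'
    exact le_of_tendsto' hy.norm hy'
  have hloc : LocallyIntegrableOn h' U μ := by
    intro y hy
    obtain ⟨s, hs, hsB⟩ := hBloc y hy
    refine ⟨s ∩ U, Filter.inter_mem hs self_mem_nhdsWithin, ?_⟩
    have hle : μ.restrict (s ∩ U) ≤ μ.restrict U := Measure.restrict_mono inter_subset_right le_rfl
    exact Integrable.mono' (hsB.mono_set inter_subset_left) (hmeas.mono_measure hle)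
      ((Measure.absolutelyContinuous_of_le hle).ae_le hbound')
  refine ⟨hloc, fun φ hφ hφc hφU => ?_⟩
  have hzero : ∀ y, y ∉ U → φ y = 0 := fun y hy =>
    image_eq_zero_of_notMem_tsupport fun h => hy (hφU h)
  refine tendsto_integral_of_dominated_convergence (fun y => ‖φ y • B y‖)
    (fun n => (integrable_smul_of_tsupport_subset (hint n) hφ hφc hφU).aestronglyMeasurable)
    (integrable_smul_of_tsupport_subset hBloc hφ hφc hφU).norm (fun n => ?_) ?_
  · filter_upwards [(ae_restrict_iff' hU.measurableSet).1 (hbound n)] with y hy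
    by_cases hyU : y ∈ U
    · rw [norm_smul, norm_smul]
      exact mul_le_mul_of_nonneg_left ((hy hyU).trans (le_abs_self _)) (norm_nonneg _)
    · simp [hzero y hyU]
  · filter_upwards [(ae_restrict_iff' hU.measurableSet).1 hlim] with y hy
    by_cases hyU : y ∈ U
    · exact (hy hyU).const_smul _
    · simp [hzero y hyU]

end TestFunctions

section WeakDifferential

variable {k m : ℕ} {H : Type*} [TopologicalSpace H]
  {I : ModelWithCorners ℝ (EuclideanSpace ℝ (Fin k)) H}
  {M : Type*} [TopologicalSpace M] [ChartedSpace H M]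

theorem ae_restrict_interior_target {x₀ : M} {P : EuclideanSpace ℝ (Fin k) → Prop}
    (h : ∀ᵐ y ∂(volume.restrict (extChartAt I x₀).target), P y) :
    ∀ᵐ y ∂(volume.restrict (interior (extChartAt I x₀).target)), P y :=
  ae_restrict_of_ae_restrict_of_subset interior_subset h

theorem ae_restrict_target_of_interior {x₀ : M} {P : EuclideanSpace ℝ (Fin k) → Prop}
    (h : ∀ᵐ y, y ∈ interior (extChartAt I x₀).target → P y) :
    ∀ᵐ y ∂(volume.restrict (extChartAt I x₀).target), P y := by
  filter_upwards [ae_mem_interior_extChartAt_target I x₀, ae_restrict_of_ae h] with y hy hP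
  exact hP hy

/-- The pullback of the Euclidean inner product by a weak differential has measurable
coefficients. -/
theorem IsWeakDifferential.aemeasurable_pullback {f : M → EuclideanSpace ℝ (Fin m)}
    {F : ∀ x : M, TangentSpace I x →ₗ[ℝ] EuclideanSpace ℝ (Fin m)}
    (hF : IsWeakDifferential I f F) (x₀ : M) (i j : Fin k) :
    AEMeasurable (fun y => pullback (F (chartInv I x₀ y)) (coordVector I x₀ y i)
      (coordVector I x₀ y j)) (volume.restrict (extChartAt I x₀).target) := by
  have hmono : volume.restrict (extChartAt I x₀).target =
      (volume.restrict (interior (extChartAt I x₀).target) :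
        Measure (EuclideanSpace ℝ (Fin k))) := by
    refine Measure.restrict_congr_set ?_
    refine Filter.EventuallyLE.antisymm ?_ interior_subset.eventuallyLE
    exact (ae_restrict_iff' (measurableSet_extChartAt_target I x₀)).1
      (ae_mem_interior_extChartAt_target I x₀)
  rw [hmono]
  exact (((hF x₀).2 i).1.aestronglyMeasurable.inner
    ((hF x₀).2 j).1.aestronglyMeasurable).aemeasurable

variable [IsManifold I ∞ M]
  (g : Bundle.ContMDiffRiemannianMetric I ∞ (EuclideanSpace ℝ (Fin k))
    (fun x : M => TangentSpace I x)) [MeasurableSpace M] [BorelSpace M]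

/-- Weak differentials are unique almost everywhere: in each chart, the values on the coordinate
vectors are determined by the test functions, first in the interior of the chart domain and then up
to the boundary, which is a null set. -/
theorem IsWeakDifferential.ae_eq [CompactSpace M] {f : M → EuclideanSpace ℝ (Fin m)}
    {F F' : ∀ x : M, TangentSpace I x →ₗ[ℝ] EuclideanSpace ℝ (Fin m)}
    (hF : IsWeakDifferential I f F) (hF' : IsWeakDifferential I f F') :
    ∀ᵐ x ∂vol g, F x = F' x := by
  refine ae_vol_of_ae_chartInv g fun x₀ => ?_
  have hi : ∀ i, ∀ᵐ y ∂(volume.restrict (extChartAt I x₀).target),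
      F (chartInv I x₀ y) (coordVector I x₀ y i) = F' (chartInv I x₀ y) (coordVector I x₀ y i) := by
    intro i
    obtain ⟨h1, h2⟩ := (hF x₀).2 i
    obtain ⟨h1', h2'⟩ := (hF' x₀).2 i
    refine ae_restrict_target_of_interior ?_
    have := isOpen_interior.ae_eq_zero_of_integral_contDiff_smul_eq_zero (h1.sub h1') ?_
    · filter_upwards [this] with y hy hyU
      exact sub_eq_zero.1 (hy hyU)
    · intro ψ hψ hψc hψU
      simp only [Pi.sub_apply, smul_sub]
      rw [integral_sub (integrable_smul_of_tsupport_subset h1 hψ.continuous hψc hψU)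
        (integrable_smul_of_tsupport_subset h1' hψ.continuous hψc hψU), sub_eq_zero]
      exact neg_injective ((h2 ψ hψ hψc hψU).symm.trans (h2' ψ hψ hψc hψU))
  filter_upwards [ae_all_iff.2 hi, ae_restrict_mem (measurableSet_extChartAt_target I x₀)]
    with y hy hyt
  obtain ⟨v, hv⟩ := exists_basis_coordVector I hyt
  refine v.ext fun i => ?_
  rw [hv]
  exact hy i

/-- Weak differentials are stable under bounded almost everywhere convergence. -/
theorem isWeakDifferential_of_tendsto {f : ℕ → M → EuclideanSpace ℝ (Fin m)}
    {f' : M → EuclideanSpace ℝ (Fin m)}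
    {F : ℕ → ∀ x : M, TangentSpace I x →ₗ[ℝ] EuclideanSpace ℝ (Fin m)}
    {F' : ∀ x : M, TangentSpace I x →ₗ[ℝ] EuclideanSpace ℝ (Fin m)} {C : ℝ}
    (hF : ∀ n, IsWeakDifferential I (f n) (F n))
    (hfb : ∀ n, ∀ᵐ x ∂vol g, ‖f n x‖ ≤ C)
    (hFb : ∀ n, ∀ᵐ x ∂vol g, ∀ u, ‖F n x u‖ ≤ C * √(metricForm g x u u))
    (hf : ∀ᵐ x ∂vol g, Filter.Tendsto (fun n => f n x) Filter.atTop (nhds (f' x)))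
    (hFlim : ∀ᵐ x ∂vol g, ∀ u, Filter.Tendsto (fun n => F n x u) Filter.atTop (nhds (F' x u))) :
    IsWeakDifferential I f' F' := by
  intro x₀
  obtain ⟨hloc, hconv⟩ := locallyIntegrableOn_of_tendsto isOpen_interior (B := fun _ => C)
    continuousOn_const (fun n => (hF n x₀).1)
    (fun n => ae_restrict_interior_target (ae_chartInv_of_ae_vol g (hfb n) x₀))
    (ae_restrict_interior_target (ae_chartInv_of_ae_vol g hf x₀))
  refine ⟨hloc, fun i => ?_⟩
  obtain ⟨hloc', hconv'⟩ := locallyIntegrableOn_of_tendsto isOpen_interior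
    (B := fun y => C * √(metricForm g (chartInv I x₀ y) (coordVector I x₀ y i)
      (coordVector I x₀ y i)))
    (h' := fun y => F' (chartInv I x₀ y) (coordVector I x₀ y i))
    ((continuousOn_const.mul (continuousOn_metricForm_coordVector g x₀ i i).sqrt).mono
      interior_subset) (fun n => ((hF n x₀).2 i).1)
    (fun n => ae_restrict_interior_target
      ((ae_chartInv_of_ae_vol g (hFb n) x₀).mono fun y hy => hy _))
    (ae_restrict_interior_target
      ((ae_chartInv_of_ae_vol g hFlim x₀).mono fun y hy => hy _))
  refine ⟨hloc', fun ψ hψ hψc hψU => ?_⟩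
  have h1 := hconv (fun y => fderiv ℝ ψ y (EuclideanSpace.single i (1 : ℝ)))
    ((hψ.continuous_fderiv (by simp)).clm_apply continuous_const)
    (hψc.fderiv_apply (𝕜 := ℝ) _) ((tsupport_fderiv_apply_subset ℝ _).trans hψU)
  have h2 := (hconv' ψ hψ.continuous hψc hψU).neg
  refine tendsto_nhds_unique h1 (h2.congr fun n => ?_)
  exact (((hF n x₀).2 i).2 ψ hψ hψc hψU).symm

end WeakDifferential

/-! ### Limits of injective linear maps -/

section LinearMaps

variable {k m : ℕ} {V : Type*} [AddCommGroup V] [Module ℝ V]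

theorem pullback_apply (A : V →ₗ[ℝ] EuclideanSpace ℝ (Fin m)) (u v : V) :
    pullback A u v = inner ℝ (A u) (A v) := by
  simp [pullback]

theorem pullback_apply_self (A : V →ₗ[ℝ] EuclideanSpace ℝ (Fin m)) (u : V) :
    pullback A u u = ‖A u‖ ^ 2 := by
  rw [pullback_apply, real_inner_self_eq_norm_sq]

theorem pullback_isInnerProduct_iff (A : V →ₗ[ℝ] EuclideanSpace ℝ (Fin m)) :
    IsInnerProduct (pullback A) ↔ ∀ u, u ≠ 0 → A u ≠ 0 := by
  constructor
  · intro h u hu h0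
    have := h.2 u hu
    rw [pullback_apply_self, h0] at this
    simp at this
  · intro h
    refine ⟨fun u v => by simp only [pullback_apply, real_inner_comm], fun u hu => ?_⟩
    rw [pullback_apply_self]
    have := norm_pos_iff.2 (h u hu)
    positivity

theorem rayDist_self {A : V →ₗ[ℝ] EuclideanSpace ℝ (Fin m)} (hA : IsInnerProduct (pullback A)) :
    rayDist A A = 0 := by
  rw [rayDist]
  refine ENNReal.iSup_eq_zero.2 fun u => ENNReal.iSup_eq_zero.2 fun hu => ?_
  rw [InnerProductGeometry.angle_self ((pullback_isInnerProduct_iff A).1 hA u hu),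
    ENNReal.ofReal_zero]

theorem rayDist_comm (A B : V →ₗ[ℝ] EuclideanSpace ℝ (Fin m)) : rayDist A B = rayDist B A := by
  simp only [rayDist, InnerProductGeometry.angle_comm]

theorem rayDist_triangle (A B C : V →ₗ[ℝ] EuclideanSpace ℝ (Fin m)) :
    rayDist A C ≤ rayDist A B + rayDist B C := by
  refine iSup₂_le fun u hu => ?_
  refine (ENNReal.ofReal_le_ofReal
    (InnerProductGeometry.angle_le_angle_add_angle (A u) (B u) (C u))).trans ?_
  refine ENNReal.ofReal_add_le.trans (add_le_add ?_ ?_)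
  · exact le_iSup₂ (f := fun u (_ : u ≠ 0) =>
      ENNReal.ofReal (InnerProductGeometry.angle (A u) (B u))) u hu
  · exact le_iSup₂ (f := fun u (_ : u ≠ 0) =>
      ENNReal.ofReal (InnerProductGeometry.angle (B u) (C u))) u hu

theorem rayDist_le_ofReal_iff {A B : V →ₗ[ℝ] EuclideanSpace ℝ (Fin m)} {r : ℝ} (hr : 0 ≤ r) :
    rayDist A B ≤ ENNReal.ofReal r ↔
      ∀ u, u ≠ 0 → InnerProductGeometry.angle (A u) (B u) ≤ r := by
  simp only [rayDist, iSup_le_iff, ENNReal.ofReal_le_ofReal_iff hr]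

theorem rayDist_le_pi (A B : V →ₗ[ℝ] EuclideanSpace ℝ (Fin m)) :
    rayDist A B ≤ ENNReal.ofReal Real.pi :=
  (rayDist_le_ofReal_iff Real.pi_pos.le).2 fun _ _ => InnerProductGeometry.angle_le_pi _ _

/-- Vectors of comparable length that span a small angle are close to each other. -/
theorem norm_sub_sq_le_of_angle_le {E : Type*} [NormedAddCommGroup E] [InnerProductSpace ℝ E]
    {a b : E} {r S : ℝ} (hr : 0 ≤ r) (ha : ‖a‖ ^ 2 ≤ S) (hb : ‖b‖ ^ 2 ≤ S)
    (hab : ‖a‖ ^ 2 ≤ Real.exp r * ‖b‖ ^ 2) (hba : ‖b‖ ^ 2 ≤ Real.exp r * ‖a‖ ^ 2)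
    (hangle : InnerProductGeometry.angle a b ≤ r) :
    ‖a - b‖ ^ 2 ≤ S * (Real.exp r - 1 + r ^ 2) := by
  have hS : 0 ≤ S := (sq_nonneg _).trans ha
  have he : 1 ≤ Real.exp r := Real.one_le_exp hr
  have hcos := InnerProductGeometry.cos_angle_mul_norm_mul_norm a b
  have hcos' := Real.one_sub_sq_div_two_le_cos (x := InnerProductGeometry.angle a b)
  have h0 := InnerProductGeometry.angle_nonneg a b
  have hsq : InnerProductGeometry.angle a b ^ 2 ≤ r ^ 2 := pow_le_pow_left₀ h0 hangle 2
  set x := ‖a‖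
  set y := ‖b‖
  have hx : 0 ≤ x := norm_nonneg a
  have hy : 0 ≤ y := norm_nonneg b
  have hxy : x * y ≤ S := by nlinarith [sq_nonneg (x - y)]
  have hxy0 : 0 ≤ x * y := mul_nonneg hx hy
  have hdiff : (x - y) ^ 2 ≤ S * (Real.exp r - 1) := by
    rcases le_total x y with h | h
    · have : (x - y) ^ 2 ≤ y ^ 2 - x ^ 2 := by nlinarith
      nlinarith
    · have : (x - y) ^ 2 ≤ x ^ 2 - y ^ 2 := by nlinarith
      nlinarith
  have hinner : x * y * (2 - r ^ 2) ≤ 2 * inner ℝ a b := by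
    rw [← hcos]
    nlinarith
  -- `‖a - b‖² = (‖a‖ - ‖b‖)² + 2 ‖a‖ ‖b‖ (1 - cos θ)` for the angle `θ`.
  rw [norm_sub_sq_real]
  nlinarith [sq_nonneg r]

theorem norm_sq_le_exp_mul (e : Module.Basis (Fin k) ℝ V)
    {A B : V →ₗ[ℝ] EuclideanSpace ℝ (Fin m)} (hA : IsInnerProduct (pullback A))
    (hB : IsInnerProduct (pullback B)) {r : ℝ}
    (h : dP e (pullback A) (pullback B) ≤ r) (u : V) :
    ‖B u‖ ^ 2 ≤ Real.exp r * ‖A u‖ ^ 2 := by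
  have := le_exp_dP_mul e hA hB u
  rw [pullback_apply_self, pullback_apply_self] at this
  exact this.trans (mul_le_mul_of_nonneg_right (Real.exp_le_exp.2 h) (sq_nonneg _))

variable {A : ℕ → V →ₗ[ℝ] EuclideanSpace ℝ (Fin m)} {r : ℕ → ℝ}

/-- A sequence of injective linear maps that is Cauchy for the distance of the pulled back inner
products and for the distance of the maps of rays converges pointwise. -/
theorem exists_tendsto_of_cauchy (e : Module.Basis (Fin k) ℝ V)
    (hA : ∀ n, IsInnerProduct (pullback (A n)))
    (hd : ∀ N n l, N ≤ n → N ≤ l → dP e (pullback (A n)) (pullback (A l)) ≤ r N)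
    (hray : ∀ N n l, N ≤ n → N ≤ l → rayDist (A n) (A l) ≤ ENNReal.ofReal (r N))
    (hr : Filter.Tendsto r Filter.atTop (nhds 0)) :
    ∃ A' : V →ₗ[ℝ] EuclideanSpace ℝ (Fin m),
      ∀ u, Filter.Tendsto (fun n => A n u) Filter.atTop (nhds (A' u)) := by
  have hr0 : ∀ N, 0 ≤ r N := fun N => (dP_nonneg e _ _).trans (hd N N N le_rfl le_rfl)
  have hex : ∀ u, ∃ z, Filter.Tendsto (fun n => A n u) Filter.atTop (nhds z) := by
    intro u
    by_cases hu : u = 0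
    · exact ⟨0, by simp [hu]⟩
    set S := Real.exp (r 0) * ‖A 0 u‖ ^ 2
    have hS : ∀ n, ‖A n u‖ ^ 2 ≤ S := fun n =>
      norm_sq_le_exp_mul e (hA 0) (hA n) (hd 0 0 n le_rfl (Nat.zero_le n)) u
    have hc : CauchySeq fun n => A n u := by
      refine cauchySeq_of_le_tendsto_0 (fun N => √(S * (Real.exp (r N) - 1 + r N ^ 2))) ?_ ?_
      · intro n l N hn hl
        rw [dist_eq_norm]
        refine Real.le_sqrt_of_sq_le (norm_sub_sq_le_of_angle_le (hr0 N) (hS n) (hS l)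
          (norm_sq_le_exp_mul e (hA l) (hA n) (hd N l n hl hn) u)
          (norm_sq_le_exp_mul e (hA n) (hA l) (hd N n l hn hl) u) ?_)
        exact (rayDist_le_ofReal_iff (hr0 N)).1 (hray N n l hn hl) u hu
      · have hcont : Continuous fun s : ℝ => √(S * (Real.exp s - 1 + s ^ 2)) := by fun_prop
        simpa [Function.comp_def] using (hcont.tendsto 0).comp hr
    exact cauchySeq_tendsto_of_complete hc
  choose f hf using hex
  exact ⟨linearMapOfTendsto f A (tendsto_pi_nhds.2 hf), hf⟩

/-- The limit of a Cauchy sequence of injective linear maps is injective, and the distances to the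
limit are controlled. -/
theorem isInnerProduct_and_dist_le_of_tendsto (e : Module.Basis (Fin k) ℝ V)
    (hA : ∀ n, IsInnerProduct (pullback (A n)))
    (hd : ∀ N n l, N ≤ n → N ≤ l → dP e (pullback (A n)) (pullback (A l)) ≤ r N)
    (hray : ∀ N n l, N ≤ n → N ≤ l → rayDist (A n) (A l) ≤ ENNReal.ofReal (r N))
    {A' : V →ₗ[ℝ] EuclideanSpace ℝ (Fin m)}
    (hlim : ∀ u, Filter.Tendsto (fun n => A n u) Filter.atTop (nhds (A' u))) :
    IsInnerProduct (pullback A') ∧ ∀ n,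
      (∀ u, ‖A' u‖ ^ 2 ≤ Real.exp (r n) * ‖A n u‖ ^ 2) ∧
      dP e (pullback (A n)) (pullback A') ≤ √k * r n ∧
      rayDist (A n) A' ≤ ENNReal.ofReal (r n) := by
  have hr0 : ∀ N, 0 ≤ r N := fun N => (dP_nonneg e _ _).trans (hd N N N le_rfl le_rfl)
  have hup : ∀ n u, ‖A' u‖ ^ 2 ≤ Real.exp (r n) * ‖A n u‖ ^ 2 := by
    intro n u
    refine le_of_tendsto ((hlim u).norm.pow 2) ?_
    filter_upwards [Filter.eventually_ge_atTop n] with l hl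
    exact norm_sq_le_exp_mul e (hA n) (hA l) (hd n n l le_rfl hl) u
  have hlow : ∀ n u, ‖A n u‖ ^ 2 ≤ Real.exp (r n) * ‖A' u‖ ^ 2 := by
    intro n u
    refine ge_of_tendsto (((hlim u).norm.pow 2).const_mul _) ?_
    filter_upwards [Filter.eventually_ge_atTop n] with l hl
    exact norm_sq_le_exp_mul e (hA l) (hA n) (hd n l n hl le_rfl) u
  have hne : ∀ u, u ≠ 0 → A' u ≠ 0 := by
    intro u hu h0
    have h1 := hlow 0 u
    have h2 := norm_pos_iff.2 ((pullback_isInnerProduct_iff (A 0)).1 (hA 0) u hu)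
    rw [h0, norm_zero] at h1
    nlinarith
  have hA' : IsInnerProduct (pullback A') := (pullback_isInnerProduct_iff A').2 hne
  refine ⟨hA', fun n => ⟨hup n, ?_, ?_⟩⟩
  · refine dP_le_of_le_exp_mul e (hA n) hA' (hr0 n) (fun u => ?_) fun u => ?_
    · simpa only [pullback_apply_self] using hup n u
    · simpa only [pullback_apply_self] using hlow n u
  · refine (rayDist_le_ofReal_iff (hr0 n)).2 fun u hu => ?_
    have hcont := (InnerProductGeometry.continuousAt_angle (x := (A n u, A' u))
      ((pullback_isInnerProduct_iff (A n)).1 (hA n) u hu) (hne u hu)).tendsto.comp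
        (tendsto_const_nhds.prodMk_nhds (hlim u))
    refine le_of_tendsto hcont ?_
    filter_upwards [Filter.eventually_ge_atTop n] with l hl
    exact (rayDist_le_ofReal_iff (hr0 n)).1 (hray n n l le_rfl hl) u hu

end LinearMaps

/-! ### The metric space of Lipschitz immersions and its completeness -/

section Immersions

variable {k m : ℕ} {H : Type*} [TopologicalSpace H]
  {I : ModelWithCorners ℝ (EuclideanSpace ℝ (Fin k)) H}
  {M : Type*} [TopologicalSpace M] [ChartedSpace H M] [IsManifold I ∞ M]
  (g : Bundle.ContMDiffRiemannianMetric I ∞ (EuclideanSpace ℝ (Fin k))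
    (fun x : M => TangentSpace I x)) [MeasurableSpace M]

theorem essSup_le_essSup_add {α : Type*} [MeasurableSpace α] {μ : Measure α} {f f₁ f₂ : α → ℝ≥0∞}
    (h : ∀ᵐ x ∂μ, f x ≤ f₁ x + f₂ x) : essSup f μ ≤ essSup f₁ μ + essSup f₂ μ :=
  (essSup_mono_ae h).trans (ENNReal.essSup_add_le f₁ f₂)

theorem ae_norm_sub_le_dist {α E : Type*} [MeasurableSpace α] {μ : Measure α}
    [NormedAddCommGroup E] (f₁ f₂ : Lp E ⊤ μ) : ∀ᵐ x ∂μ, ‖f₁ x - f₂ x‖ ≤ dist f₁ f₂ := by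
  filter_upwards [ae_le_eLpNormEssSup (f := (f₁ - f₂ : α → E)) (μ := μ)] with x hx
  rw [← eLpNorm_exponent_top, ← Lp.edist_def, edist_dist, ← ofReal_norm,
    ENNReal.ofReal_le_ofReal_iff dist_nonneg] at hx
  exact hx

theorem differential_spec {f : Lp (EuclideanSpace ℝ (Fin m)) ⊤ (vol g)}
    (hf : f ∈ sobolevOneInfty g m) : IsLInftyDifferential g f (differential g f) := by
  rw [differential, dif_pos hf]
  exact hf.choose_spec

variable {g}

theorem dPSup_self {b : ∀ x : M, LinearMap.BilinForm ℝ (TangentSpace I x)}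
    (hb : ∀ᵐ x ∂vol g, IsInnerProduct (b x)) : dPSup g b b = 0 := by
  rw [dPSup, ENNReal.essSup_eq_zero_iff]
  filter_upwards [hb] with x hx
  simp [dP_self _ hx]

theorem dPSup_comm {b c : ∀ x : M, LinearMap.BilinForm ℝ (TangentSpace I x)}
    (hb : ∀ᵐ x ∂vol g, IsInnerProduct (b x)) (hc : ∀ᵐ x ∂vol g, IsInnerProduct (c x)) :
    dPSup g b c = dPSup g c b := by
  refine essSup_congr_ae ?_
  filter_upwards [hb, hc] with x hx hx'
  rw [dP_comm _ hx hx']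

theorem dPSup_triangle {a b c : ∀ x : M, LinearMap.BilinForm ℝ (TangentSpace I x)}
    (ha : ∀ᵐ x ∂vol g, IsInnerProduct (a x)) (hb : ∀ᵐ x ∂vol g, IsInnerProduct (b x))
    (hc : ∀ᵐ x ∂vol g, IsInnerProduct (c x)) : dPSup g a c ≤ dPSup g a b + dPSup g b c := by
  refine essSup_le_essSup_add ?_
  filter_upwards [ha, hb, hc] with x hax hbx hcx
  rw [← ENNReal.ofReal_add (dP_nonneg _ _ _) (dP_nonneg _ _ _)]
  exact ENNReal.ofReal_le_ofReal (dP_triangle _ hax hbx hcx)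

theorem ae_isInnerProduct_metricForm : ∀ᵐ x ∂vol g, IsInnerProduct (metricForm g x) :=
  Filter.Eventually.of_forall (metricForm_isInnerProduct g)

variable (g m) in
/-- `d_Imm` as an extended distance on the space of Lipschitz immersions. -/
noncomputable abbrev immEMetricSpace : EMetricSpace (Imm g m) where
  edist f₁ f₂ := dImm g f₁ f₂
  edist_self f := by
    have h3 : essSup (fun x => rayDist (differential g f.1 x) (differential g f.1 x)) (vol g)
        = 0 := by
      rw [ENNReal.essSup_eq_zero_iff]
      filter_upwards [f.2.2.isInnerProduct] with x hx
      exact rayDist_self hx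
    rw [dImm, dPSup_self f.2.2.isInnerProduct, h3, sub_self, eLpNorm_zero, add_zero, add_zero]
  edist_comm f₁ f₂ := by
    rw [dImm, dImm, ← Lp.edist_def, ← Lp.edist_def, edist_comm,
      dPSup_comm f₁.2.2.isInnerProduct f₂.2.2.isInnerProduct]
    simp only [rayDist_comm (differential g f₁.1 _)]
  edist_triangle f₁ f₂ f₃ := by
    simp only [dImm, ← Lp.edist_def]
    have h1 := edist_triangle f₁.1 f₂.1 f₃.1
    have h2 := dPSup_triangle f₁.2.2.isInnerProduct f₂.2.2.isInnerProduct f₃.2.2.isInnerProduct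
    have h3 : essSup (fun x => rayDist (differential g f₁.1 x) (differential g f₃.1 x)) (vol g) ≤
        essSup (fun x => rayDist (differential g f₁.1 x) (differential g f₂.1 x)) (vol g) +
        essSup (fun x => rayDist (differential g f₂.1 x) (differential g f₃.1 x)) (vol g) :=
      essSup_le_essSup_add (Filter.Eventually.of_forall fun x => rayDist_triangle _ _ _)
    refine (add_le_add (add_le_add h1 h2) h3).trans (le_of_eq ?_)
    ring
  eq_of_edist_eq_zero {f₁ f₂} h := by
    have h : dImm g f₁ f₂ = 0 := h
    simp only [dImm, ← Lp.edist_def, add_eq_zero, edist_eq_zero] at h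
    exact Subtype.ext h.1.1

theorem dImm_ne_top (f₁ f₂ : Imm g m) : dImm g f₁ f₂ ≠ ⊤ := by
  rw [dImm, ← Lp.edist_def]
  refine ENNReal.add_ne_top.2 ⟨ENNReal.add_ne_top.2 ⟨edist_ne_top _ _, ?_⟩, ?_⟩
  · have h1 := f₁.2.2.bounded
    have h2 := f₂.2.2.bounded
    rw [dPSup_comm f₂.2.2.isInnerProduct ae_isInnerProduct_metricForm] at h2
    exact ((dPSup_triangle f₁.2.2.isInnerProduct ae_isInnerProduct_metricForm
      f₂.2.2.isInnerProduct).trans_lt (ENNReal.add_lt_top.2 ⟨h1, h2⟩)).ne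
  · refine ne_top_of_le_ne_top ENNReal.ofReal_ne_top (b := ENNReal.ofReal Real.pi) ?_
    exact essSup_le_of_ae_le _ (Filter.Eventually.of_forall fun x => rayDist_le_pi _ _)

variable [BorelSpace M] [CompactSpace M]

/-- A sequence of Lipschitz immersions that is Cauchy with the rate `r` converges. The differentials
converge pointwise almost everywhere and are dominated, so that their limit is the differential of
the uniform limit. -/
theorem exists_tendsto_dImm {f : ℕ → Imm g m} {r : ℕ → ℝ}
    (hr : Filter.Tendsto r Filter.atTop (nhds 0)) (hr0 : ∀ N, 0 ≤ r N)
    (hf : ∀ N n l, N ≤ n → N ≤ l → dImm g (f n) (f l) ≤ ENNReal.ofReal (r N)) :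
    ∃ f' : Imm g m, Filter.Tendsto (fun n => dImm g (f n) f') Filter.atTop (nhds 0) := by
  set F := fun n => differential g (f n).1 with hFdef
  set e : ∀ x : M, Module.Basis (Fin k) ℝ (TangentSpace I x) := tangentBasis I
  have hF : ∀ n, IsLInftyDifferential g (f n).1 (F n) := fun n => differential_spec g (f n).2.1
  -- Each of the three terms of `d_Imm` inherits the rate `r`. There are countably many pairs of
  -- indices, so the two essential suprema give bounds off a single null set.
  have hLp : ∀ N n l, N ≤ n → N ≤ l → dist (f n).1 (f l).1 ≤ r N := by
    intro N n l hn hl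
    have h := hf N n l hn hl
    rw [dImm, ← Lp.edist_def, add_assoc] at h
    have := le_self_add.trans h
    rwa [edist_dist, ENNReal.ofReal_le_ofReal_iff (hr0 N)] at this
  have hinner : ∀ᵐ x ∂vol g, ∀ n, IsInnerProduct (pullback (F n x)) :=
    ae_all_iff.2 fun n => (f n).2.2.isInnerProduct
  have hd : ∀ᵐ x ∂vol g, ∀ N n l, N ≤ n → N ≤ l →
      dP (e x) (pullback (F n x)) (pullback (F l x)) ≤ r N := by
    simp only [ae_all_iff]
    intro N n l hn hl
    have h := hf N n l hn hl
    rw [dImm] at h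
    have h' := (le_add_self.trans le_self_add).trans h
    rw [dPSup] at h'
    filter_upwards [ENNReal.ae_le_essSup (μ := vol g) fun x => ENNReal.ofReal
      (dP (tangentBasis I x) (pullback (differential g (f n).1 x))
        (pullback (differential g (f l).1 x)))] with x hx
    exact (ENNReal.ofReal_le_ofReal_iff (hr0 N)).1 (hx.trans h')
  have hray : ∀ᵐ x ∂vol g, ∀ N n l, N ≤ n → N ≤ l →
      rayDist (F n x) (F l x) ≤ ENNReal.ofReal (r N) := by
    simp only [ae_all_iff]
    intro N n l hn hl
    have h := hf N n l hn hl
    rw [dImm] at h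
    have h' := le_add_self.trans h
    filter_upwards [ENNReal.ae_le_essSup (μ := vol g) fun x =>
      rayDist (differential g (f n).1 x) (differential g (f l).1 x)] with x hx
    exact hx.trans h'
  -- `F'` is the pointwise limit of the differentials, with the value `0` on the null set where there
  -- is none.
  obtain ⟨φ, hφ⟩ := cauchySeq_tendsto_of_complete (cauchySeq_of_le_tendsto_0 r
    (fun n l N hn hl => hLp N n l hn hl) hr)
  classical
  let F' : ∀ x : M, TangentSpace I x →ₗ[ℝ] EuclideanSpace ℝ (Fin m) := fun x =>
    if h : ∃ A' : TangentSpace I x →ₗ[ℝ] EuclideanSpace ℝ (Fin m),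
      ∀ u, Filter.Tendsto (fun n => F n x u) Filter.atTop (nhds (A' u)) then h.choose else 0
  have hF' : ∀ᵐ x ∂vol g, ∀ u, Filter.Tendsto (fun n => F n x u) Filter.atTop (nhds (F' x u)) := by
    filter_upwards [hinner, hd, hray] with x h1 h2 h3
    have h := exists_tendsto_of_cauchy (A := fun n => F n x) (e x) h1 h2 h3 hr
    simp only [F', dif_pos h]
    exact h.choose_spec
  have hlim := (hinner.and (hd.and (hray.and hF'))).mono fun x hx =>
    isInnerProduct_and_dist_le_of_tendsto (A := fun n => F n x) (e x) hx.1 hx.2.1 hx.2.2.1 hx.2.2.2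
  obtain ⟨C₀, hC₀⟩ := (hF 0).2
  set E := Real.exp (r 0) with hE
  have hE1 : 1 ≤ E := Real.one_le_exp (hr0 0)
  -- `C` bounds all maps, as well as all differentials with respect to `g`.
  set C := max (E * C₀) (‖(f 0).1‖ + r 0)
  have hdom : ∀ᵐ x ∂vol g, ∀ (z : EuclideanSpace ℝ (Fin m)) u,
      ‖z‖ ^ 2 ≤ E * ‖F 0 x u‖ ^ 2 → ‖z‖ ≤ C * √(metricForm g x u u) := by
    filter_upwards [hC₀] with x hx z u hz
    have h1 : ‖z‖ ≤ E * ‖F 0 x u‖ := by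
      refine abs_le_of_sq_le_sq' ?_ (by positivity) |>.2
      nlinarith [sq_nonneg ‖F 0 x u‖]
    calc ‖z‖ ≤ E * ‖F 0 x u‖ := h1
      _ ≤ E * (C₀ * √(metricForm g x u u)) := mul_le_mul_of_nonneg_left (hx u) (by positivity)
      _ = (E * C₀) * √(metricForm g x u u) := by ring
      _ ≤ C * √(metricForm g x u u) :=
        mul_le_mul_of_nonneg_right (le_max_left _ _) (Real.sqrt_nonneg _)
  have hweak : IsWeakDifferential I φ F' := by
    refine isWeakDifferential_of_tendsto g (f := fun n => (f n).1) (F := F) (C := C)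
      (fun n => (hF n).1) (fun n => ?_) (fun n => ?_) ?_ hF'
    · filter_upwards [ae_norm_sub_le_dist (f n).1 0, Lp.coeFn_zero (EuclideanSpace ℝ (Fin m)) ⊤
        (vol g)] with x hx hx0
      rw [hx0, Pi.zero_apply, sub_zero] at hx
      refine hx.trans (le_trans ?_ (le_max_right _ _))
      have h1 := dist_triangle (f n).1 (f 0).1 0
      have h2 := hLp 0 n 0 (Nat.zero_le n) le_rfl
      rw [dist_zero_right (f 0).1] at h1
      linarith
    · filter_upwards [hdom, hinner, hd] with x hx h1 h2 u
      exact hx _ u (norm_sq_le_exp_mul (e x) (h1 0) (h1 n) (h2 0 0 n le_rfl (Nat.zero_le n)) u)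
    · filter_upwards [ae_all_iff.2 fun n => ae_norm_sub_le_dist (f n).1 φ] with x hx
      rw [tendsto_iff_norm_sub_tendsto_zero]
      exact squeeze_zero (fun n => norm_nonneg _) hx (tendsto_iff_dist_tendsto_zero.1 hφ)
  have hφS : φ ∈ sobolevOneInfty g m := by
    refine ⟨F', hweak, C, ?_⟩
    filter_upwards [hdom, hlim] with x hx hx' u
    exact hx _ u ((hx'.2 0).1 u)
  have hspec := differential_spec g hφS
  have hlim' : ∀ᵐ x ∂vol g, IsInnerProduct (pullback (differential g φ x)) ∧ ∀ n,
      dP (e x) (pullback (F n x)) (pullback (differential g φ x)) ≤ √k * r n ∧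
      rayDist (F n x) (differential g φ x) ≤ ENNReal.ofReal (r n) := by
    filter_upwards [hlim, hspec.1.ae_eq g hweak] with x hx hx'
    rw [hx']
    exact ⟨hx.1, fun n => (hx.2 n).2⟩
  have hinnerφ := hlim'.mono fun x hx => hx.1
  have hdφ : ∀ n, dPSup g (fun x => pullback (F n x)) (fun x => pullback (differential g φ x)) ≤
      ENNReal.ofReal (√k * r n) := fun n =>
    essSup_le_of_ae_le _ (hlim'.mono fun x hx => ENNReal.ofReal_le_ofReal (hx.2 n).1)
  have hP : MemP g fun x => pullback (differential g φ x) := by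
    refine ⟨hspec.1.aemeasurable_pullback, hinnerφ, ?_⟩
    refine (dPSup_triangle hinnerφ (f 0).2.2.isInnerProduct
      ae_isInnerProduct_metricForm).trans_lt (ENNReal.add_lt_top.2 ⟨?_, (f 0).2.2.bounded⟩)
    rw [dPSup_comm hinnerφ (f 0).2.2.isInnerProduct]
    exact (hdφ 0).trans_lt ENNReal.ofReal_lt_top
  refine ⟨⟨φ, hφS, hP⟩, ?_⟩
  have hbound : ∀ n, dImm g (f n) ⟨φ, hφS, hP⟩ ≤
      edist (f n).1 φ + ENNReal.ofReal (√k * r n) + ENNReal.ofReal (r n) := by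
    intro n
    unfold dImm
    rw [← Lp.edist_def]
    refine add_le_add (add_le_add le_rfl (hdφ n)) ?_
    exact essSup_le_of_ae_le _ (hlim'.mono fun x hx => (hx.2 n).2)
  refine tendsto_of_tendsto_of_tendsto_of_le_of_le tendsto_const_nhds ?_
    (fun n => bot_le) hbound
  have h1 := tendsto_iff_edist_tendsto_0.1 hφ
  have h2 : Filter.Tendsto (fun n => ENNReal.ofReal (√k * r n)) Filter.atTop (nhds 0) := by
    simpa using ENNReal.tendsto_ofReal (hr.const_mul √(k : ℝ))
  have h3 : Filter.Tendsto (fun n => ENNReal.ofReal (r n)) Filter.atTop (nhds 0) := by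
    simpa using ENNReal.tendsto_ofReal hr
  simpa using (h1.add h2).add h3

theorem completeSpace_imm :
    @CompleteSpace (Imm g m) (immEMetricSpace m g).toUniformSpace := by
  let _ := immEMetricSpace m g
  refine EMetric.complete_of_convergent_controlled_sequences
    (fun N => ENNReal.ofReal (1 / ((N : ℝ) + 1)))
    (fun N => ENNReal.ofReal_pos.2 Nat.one_div_pos_of_nat) fun f hf => ?_
  obtain ⟨f', hf'⟩ := exists_tendsto_dImm (f := f) tendsto_one_div_add_atTop_nhds_zero_nat
    (fun N => Nat.one_div_pos_of_nat.le) fun N n l hn hl => (hf N n l hn hl).le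
  exact ⟨f', tendsto_iff_edist_tendsto_0.2 hf'⟩

end Immersions

end LipschitzImmersion

theorem mainTheorem4 {k : ℕ} (m : ℕ) {H : Type*} [TopologicalSpace H]
    (I : ModelWithCorners ℝ (EuclideanSpace ℝ (Fin k)) H)
    {M : Type*} [TopologicalSpace M] [ChartedSpace H M] [IsManifold I ∞ M]
    [CompactSpace M] [T2Space M] [MeasurableSpace M] [BorelSpace M]
    (g : Bundle.ContMDiffRiemannianMetric I ∞ (EuclideanSpace ℝ (Fin k))
      (fun x : M => TangentSpace I x)) :
    ∃ _ : MetricSpace (LipschitzImmersion.Imm g m),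
      (∀ f₁ f₂ : LipschitzImmersion.Imm g m, edist f₁ f₂ = LipschitzImmersion.dImm g f₁ f₂) ∧
      CompleteSpace (LipschitzImmersion.Imm g m) := by
  let _ := LipschitzImmersion.immEMetricSpace m g
  exact ⟨EMetricSpace.toMetricSpace LipschitzImmersion.dImm_ne_top, fun _ _ => rfl,
    LipschitzImmersion.completeSpace_imm⟩
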